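/- Let $\omega>0$ and $\omega'=it$ with $t>0$, and let $\wp,\zeta,\sigma$ be the Weierstrass functions of the lattice $\Lambda=2\omega\mathbb Z+2\omega'\mathbb Z$, with invariant $g_2$. Consider the Hamiltonian $h_0=-\partial^2+V_0(x)$, $x\in\mathbb R$, with $V_0(x)=6\wp(x+\omega')$, which has period $2\omega$. Let $d\in\mathbb C\setminus\Lambda$, put $\wp_0=\wp(d)$, let $\sqrt{g_2-3\wp_0^2}$ denote either square root, and put $$a_1=-\tfrac32\Big[\wp_0-\sqrt{g_2-3\wp_0^2}\Big],\qquad a_2=-\tfrac32\Big[\wp_0+\sqrt{g_2-3\wp_0^2}\Big],$$ $$p=\frac{3S'}{D},\qquad S(x)=V_0(x)+V_0(x+d),\quad D(x)=V_0(x)-V_0(x+d).$$ There are $x_1,x_2\in\mathbb C$ with $$\wp(x_1+\omega')=-\tfrac12\wp_0+\tfrac12\sqrt{g_2-3\wp_0^2},\qquad \wp(x_2+\omega')=-\tfrac12\wp_0-\tfrac12\sqrt{g_2-3\wp_0^2},\qquad x_1+x_2\equiv-d\pmod\Lambda .$$ For any such $x_1,x_2$ put $b=\tfrac12\zeta(\omega'-x_2)-\tfrac12\zeta(\omega'-x_1)$.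 Then the formulas $$u_2^-(x)=\pm\sqrt{p(x)}\left(\frac{\sigma(x+\omega'+d)}{\sigma(x+\omega')}\right)^{3/2}\left(\frac{\sigma(x-x_1)}{\sigma(x-x_2)}\right)^{1/2}e^{(b-\frac32\zeta(d))x},\qquad u_2^+(x+d)=\frac{p(x)}{u_2^-(x)},$$ $$u_1^-(x+d)=u_2^-(x)\left(\frac{\sigma(x+\omega')}{\sigma(x+\omega'+d)}\right)^{3}e^{3\zeta(d)x},\qquad u_1^+(x)=\frac{p(x)}{u_1^-(x+d)}$$ define functions that are holomorphic on $\mathbb C\setminus(\omega'+\Lambda)$: the branches of the powers can be chosen so that $u_2^-$ is holomorphic there, removable singularities being removed. For every such choice of $u_2^-$, the restrictions of $u_2^+,u_2^-$ to $\mathbb R$ are Bloch eigenfunctions of $h_0$ with eigenvalue $a_2$, and those of $u_1^+,u_1^-$ are Bloch eigenfunctions of $h_0$ with eigenvalue $a_1$. That is, for $i=1,2$ the functions $u_i^\pm$ are not identically zero, $h_0u_i^\pm=a_iu_i^\pm$ on $\mathbb R$, and $u_i^\pm(x+2\omega)=\beta_i^{\pm1}u_i^\pm(x)$ for some $\beta_i\in\mathbb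 C\setminus\{0\}$. Moreover $u_i^+$ and $u_i^-$ are linearly independent whenever $a_i$ is not one of the band edges $3\wp(\omega),\,3\wp(\omega+\omega'),\,3\wp(\omega'),\,\pm\sqrt{3g_2}$. -/

import Mathlib

noncomputable section

namespace LameInce

/-- The Weierstrass zeta function
`ζ(z) = 1/z + ∑_{l ≠ 0} (1/(z - l) + 1/l + z/l²)` of the lattice of `L`.
The term `l = 0` of the sum below is `1/z`, because `1/0 = 0`. -/
def weierstrassZeta (L : PeriodPair) (z : ℂ) : ℂ :=
  ∑' l : L.lattice, (1 / (z - (l : ℂ)) + 1 / (l : ℂ) + z / (l : ℂ) ^ 2)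

/-- The Weierstrass sigma function
`σ(z) = z ∏_{l ≠ 0} (1 - z/l) exp(z/l + z²/(2 l²))` of the lattice of `L`.
The factor `l = 0` of the product below is `1`, because `z/0 = 0`. -/
def weierstrassSigma (L : PeriodPair) (z : ℂ) : ℂ :=
  z * ∏' l : L.lattice,
    ((1 - z / (l : ℂ)) * Complex.exp (z / (l : ℂ) + z ^ 2 / (2 * (l : ℂ) ^ 2)))

/-- The potential `V₀(x) = 6 ℘(x + ω')`. -/
def V₀ (L : PeriodPair) (ω' x : ℂ) : ℂ := 6 * L.weierstrassP (x + ω')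

/-- `S(x) = V₀(x) + V₀(x + d)`. -/
def S (L : PeriodPair) (ω' d x : ℂ) : ℂ := V₀ L ω' x + V₀ L ω' (x + d)

/-- `D(x) = V₀(x) - V₀(x + d)`. -/
def D (L : PeriodPair) (ω' d x : ℂ) : ℂ := V₀ L ω' x - V₀ L ω' (x + d)

/-- `p = 3 S' / D`, which is used only off the zeros of `D` and the poles of `S` and `D`. -/
def p (L : PeriodPair) (ω' d x : ℂ) : ℂ := 3 * (deriv (S L ω' d) x / D L ω' d x)

/-- The factorization constant `a₁ = -(3/2) (℘(d) - r)`, with `r = √(g₂ - 3 ℘(d)²)`. -/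
def a₁ (L : PeriodPair) (d r : ℂ) : ℂ := -(3 / 2) * (L.weierstrassP d - r)

/-- The factorization constant `a₂ = -(3/2) (℘(d) + r)`, with `r = √(g₂ - 3 ℘(d)²)`. -/
def a₂ (L : PeriodPair) (d r : ℂ) : ℂ := -(3 / 2) * (L.weierstrassP d + r)

/-- `x₁ = ℘⁻¹(-℘(d)/2 + r/2) - ω'` and `x₂ = ℘⁻¹(-℘(d)/2 - r/2) - ω'`. A value of `℘` determines
its argument only up to sign and periods; the sheets of `℘⁻¹` are matched by
`x₁ + x₂ ≡ -d` modulo the periods. -/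
structure IsNodePair (L : PeriodPair) (ω' d r x₁ x₂ : ℂ) : Prop where
  notMem₁ : x₁ + ω' ∉ L.lattice
  notMem₂ : x₂ + ω' ∉ L.lattice
  wp₁ : L.weierstrassP (x₁ + ω') = -(1 / 2) * L.weierstrassP d + 1 / 2 * r
  wp₂ : L.weierstrassP (x₂ + ω') = -(1 / 2) * L.weierstrassP d - 1 / 2 * r
  sheet : x₁ + x₂ + d ∈ L.lattice

/-- `b = ½ ζ(ω' - x₂) - ½ ζ(ω' - x₁)`. -/
def b (L : PeriodPair) (ω' x₁ x₂ : ℂ) : ℂ :=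
  1 / 2 * weierstrassZeta L (ω' - x₂) - 1 / 2 * weierstrassZeta L (ω' - x₁)

/-- `√p (σ(x+ω'+d)/σ(x+ω'))^{3/2} (σ(x-x₁)/σ(x-x₂))^{1/2} exp((b - (3/2) ζ(d)) x)`, with the
principal value of each power at each point. -/
def rootFormula (L : PeriodPair) (ω' d x₁ x₂ x : ℂ) : ℂ :=
  (p L ω' d x) ^ (1 / 2 : ℂ)
    * (weierstrassSigma L (x + ω' + d) / weierstrassSigma L (x + ω')) ^ (3 / 2 : ℂ)
    * (weierstrassSigma L (x - x₁) / weierstrassSigma L (x - x₂)) ^ (1 / 2 : ℂ)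
    * Complex.exp ((b L ω' x₁ x₂ - 3 / 2 * weierstrassZeta L d) * x)

/-- The points at which one of the quotients in the formulas is not defined or vanishes. -/
def exceptionalSet (L : PeriodPair) (ω' d x₁ x₂ : ℂ) : Set ℂ :=
  {x | x + ω' ∈ L.lattice ∨ x + ω' + d ∈ L.lattice ∨ x - x₁ ∈ L.lattice ∨ x - x₂ ∈ L.lattice ∨
    D L ω' d x = 0}

/-- The complement of the poles of `V₀`. -/
def regularSet (L : PeriodPair) (ω' : ℂ) : Set ℂ := {x | x + ω' ∉ L.lattice}

/-- `u₂⁻, u₂⁺, u₁⁻, u₁⁺` are given by the explicit formulas: they are holomorphic off the poles of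
`V₀` and the formulas hold off the exceptional set. In `formula_two_minus` the sign `±` may depend
on the point, as the principal values of the powers jump; holomorphy of `u₂⁻` makes the choice of
the branches consistent and removes the removable singularities. -/
structure IsGivenByFormulas (L : PeriodPair) (ω' d x₁ x₂ : ℂ)
    (u₂m u₂p u₁m u₁p : ℂ → ℂ) : Prop where
  holo_two_minus : DifferentiableOn ℂ u₂m (regularSet L ω')
  holo_two_plus : DifferentiableOn ℂ u₂p (regularSet L ω')
  holo_one_minus : DifferentiableOn ℂ u₁m (regularSet L ω')
  holo_one_plus : DifferentiableOn ℂ u₁p (regularSet L ω')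
  formula_two_minus : ∀ x ∉ exceptionalSet L ω' d x₁ x₂,
    u₂m x = rootFormula L ω' d x₁ x₂ x ∨ u₂m x = -rootFormula L ω' d x₁ x₂ x
  formula_two_plus : ∀ x ∉ exceptionalSet L ω' d x₁ x₂, u₂p (x + d) = p L ω' d x / u₂m x
  formula_one_minus : ∀ x ∉ exceptionalSet L ω' d x₁ x₂,
    u₁m (x + d) = u₂m x * (weierstrassSigma L (x + ω') / weierstrassSigma L (x + ω' + d)) ^ 3
      * Complex.exp (3 * weierstrassZeta L d * x)
  formula_one_plus : ∀ x ∉ exceptionalSet L ω' d x₁ x₂, u₁p x = p L ω' d x / u₁m (x + d)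

/-- `ψ` is a nonzero `C²` solution of `-ψ'' + V ψ = a ψ` on the real line. -/
def IsEigenfunction (V : ℝ → ℂ) (a : ℂ) (ψ : ℝ → ℂ) : Prop :=
  ContDiff ℝ 2 ψ ∧ (∃ x, ψ x ≠ 0) ∧ ∀ x, -deriv (deriv ψ) x + V x * ψ x = a * ψ x

/-- `ψp` and `ψm` are eigenfunctions for `a` with reciprocal Bloch factors over the period `T`:
`ψp (x + T) = β ψp x` and `ψm (x + T) = β⁻¹ ψm x`. -/
def IsBlochPair (V : ℝ → ℂ) (T : ℝ) (a : ℂ) (ψp ψm : ℝ → ℂ) : Prop :=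
  IsEigenfunction V a ψp ∧ IsEigenfunction V a ψm ∧
    ∃ β : ℂ, β ≠ 0 ∧ ∀ x, ψp (x + T) = β * ψp x ∧ ψm (x + T) = β⁻¹ * ψm x

/-- `a` is one of the band edges `3 e₁, 3 e₂, 3 e₃, ± √(3 g₂)` of `-∂² + 6 ℘(x + ω')`, where
`e₁ = ℘(ω)`, `e₂ = ℘(ω + ω')`, `e₃ = ℘(ω')`. -/
def IsBandEdge (L : PeriodPair) (ω ω' a : ℂ) : Prop :=
  a = 3 * L.weierstrassP ω ∨ a = 3 * L.weierstrassP (ω + ω') ∨ a = 3 * L.weierstrassP ω' ∨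
    a ^ 2 = 3 * L.g₂

end LameInce

end

/-! Everything rests on G(z) = ζ(z+d) - ζ(z) - ζ(d), an elliptic function with simple poles at 0 and
-d. By Liouville, G² = ℘(z) + ℘(z+d) + ℘(d) (`zetaDefect_sq`); differentiating once gives p(x) = 6
G(x+ω'), and differentiating again shows that at a zero c of G the numbers ℘(c), ℘(c+d) are the
roots of X² + ℘(d) X + ℘(d)² - g₂/4. Its discriminant is g₂ - 3℘(d)², so the nodes x₁+ω', x₂+ω' are,
modulo Λ, the two zeros c and -d-c of G.

Since σ'/σ = ζ, comparing logarithmic derivatives writes G as a constant times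
σ(z-c)σ(z+d+c)/(σ(z)σ(z+d)) (`exists_zetaDefect_factorization`). Inserted in the formulas, this
makes the square of the root expression a constant times φ(x+ω')², where φ = `halphen L d c` is
single valued (`exists_sq_rootFormula`). A holomorphic u₂⁻ is therefore a multiple of φ(x+ω'). The
other formulas give multiples of φ(-(x+ω')) and of the same two functions for the reflected zero
-d-c.

The logarithmic derivative of φ is G(z,-c) + G(z,d), and the addition theorem turns this into Lamé's
equation with eigenvalue 3℘(c+d) (`IsNode.lame_halphen`), which is a₂ for c and a₁ for -d-c.
Quasi-periodicity of σ gives the Bloch factors. If φ(z) and φ(-z) are dependent, their zero sets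
{c,-d} and {-c,d} agree modulo Λ, which forces a band edge (`IsNode.of_dependent`,
`IsNode.isBandEdge`). -/

namespace LameInce

open Filter Topology Set

/-! ### Countable exceptional sets and Liouville's theorem -/

section

/-- The complement of a countable set is dense. Identities proved where no denominator vanishes are
carried across the remaining points in this way. -/
lemma eqOn_of_eq_off_countable {f g : ℂ → ℂ} {U S : Set ℂ} (hU : IsOpen U) (hS : S.Countable)
    (hf : ContinuousOn f U) (hg : ContinuousOn g U) (h : ∀ z ∈ U, z ∉ S → f z = g z) :
    EqOn f g U := by
  have hd : Dense Sᶜ := hS.dense_compl ℝ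
  have h' : EqOn f g (U ∩ Sᶜ) := fun z hz ↦ h z hz.1 hz.2
  exact h'.of_subset_closure hf hg inter_subset_left (hd.open_subset_closure_inter hU)

lemma isPreconnected_compl {S : Set ℂ} (hS : S.Countable) : IsPreconnected Sᶜ :=
  (hS.isConnected_compl_of_one_lt_rank (by simp)).2

/-- A countable set does not disconnect the plane, so there is a single constant. Applied to
quotients with vanishing logarithmic derivative, this yields the sigma identities. -/
lemma exists_const_of_hasDerivAt_zero {f : ℂ → ℂ} {S : Set ℂ} (hS : S.Countable)
    (hc : IsClosed S) (hf : ∀ z ∉ S, HasDerivAt f 0 z) : ∃ c, ∀ z ∉ S, f z = c := by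
  obtain ⟨c, h⟩ := hc.isOpen_compl.exists_is_const_of_deriv_eq_zero (isPreconnected_compl hS)
    (f := f) (fun z hz ↦ (hf z hz).differentiableAt.differentiableWithinAt)
    (fun z hz ↦ (hf z hz).deriv)
  exact ⟨c, h⟩

lemma countable_zeros {f : ℂ → ℂ} {U : Set ℂ} (hf : AnalyticOnNhd ℂ f U)
    (hU : IsPreconnected U) {z₀ : ℂ} (h₀ : z₀ ∈ U) (hz₀ : f z₀ ≠ 0) :
    {z | z ∈ U ∧ f z = 0}.Countable := by
  have : DiscreteTopology {z | z ∈ U ∧ f z = 0} := by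
    rw [discreteTopology_subtype_iff]
    rintro z ⟨hz, -⟩
    rcases (hf z hz).eventually_eq_zero_or_eventually_ne_zero with h | h
    · exact absurd (hf.eqOn_zero_of_preconnected_of_eventuallyEq_zero hU hz h h₀) hz₀
    · rw [← disjoint_iff, disjoint_principal_right]
      filter_upwards [h] with w hw using fun h' ↦ hw h'.2
  exact (countable_of_Lindelof_of_discrete (X := {z | z ∈ U ∧ f z = 0}))

variable (L : PeriodPair)

lemma countable_lattice : (L.lattice : Set ℂ).Countable :=
  (countable_of_Lindelof_of_discrete (X := L.lattice))

/-- The translate `Λ - c` of the lattice. -/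
def latticeSub (c : ℂ) : Set ℂ := {z | z + c ∈ L.lattice}

@[simp] lemma mem_latticeSub {c z : ℂ} : z ∈ latticeSub L c ↔ z + c ∈ L.lattice := Iff.rfl

lemma countable_latticeSub (c : ℂ) : (latticeSub L c).Countable :=
  (countable_lattice L).preimage (add_left_injective c)

lemma isClosed_latticeSub (c : ℂ) : IsClosed (latticeSub L c) :=
  L.isClosed_lattice.preimage (continuous_add_const c)

lemma isOpen_compl_latticeSub (c : ℂ) : IsOpen (latticeSub L c)ᶜ :=
  (isClosed_latticeSub L c).isOpen_compl

lemma hasDerivAt_weierstrassP {z : ℂ} (hz : z ∉ L.lattice) :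
    HasDerivAt L.weierstrassP (L.derivWeierstrassP z) z := by
  rw [← L.deriv_weierstrassP]
  exact (L.analyticOnNhd_weierstrassP z hz).differentiableAt.hasDerivAt

/-- An entire function with the lattice as periods is constant. -/
lemma periodic_const {f : ℂ → ℂ} (hf : Differentiable ℂ f)
    (hp : ∀ z, ∀ l ∈ L.lattice, f (z + l) = f z) (z w : ℂ) : f z = f w :=
  hf.apply_eq_apply_of_bounded (IsZLattice.isCompact_range_of_periodic L.lattice f
    hf.continuous fun z l hl ↦ hp z l hl).isBounded z w

/-- Liouville's theorem for elliptic functions with removable singularities at `0` and `-d`. -/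
lemma eq_of_elliptic {f : ℂ → ℂ} {d a b : ℂ} (hd : d ∉ L.lattice)
    (hf : ∀ z, z ∉ L.lattice → z + d ∉ L.lattice → DifferentiableAt ℂ f z)
    (hp : ∀ z, z ∉ L.lattice → z + d ∉ L.lattice → ∀ l ∈ L.lattice, f (z + l) = f z)
    (ha : Tendsto f (𝓝[≠] 0) (𝓝 a)) (hb : Tendsto f (𝓝[≠] (-d)) (𝓝 b))
    {z : ℂ} (hz : z ∉ L.lattice) (hzd : z + d ∉ L.lattice) : f z = a := by
  classical
  set g : ℂ → ℂ := fun z ↦ if z ∈ L.lattice then a else if z + d ∈ L.lattice then b else f z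
    with hg
  have hgp : ∀ z, ∀ l ∈ L.lattice, g (z + l) = g z := by
    intro z l hl
    have e₁ : z + l ∈ L.lattice ↔ z ∈ L.lattice :=
      L.lattice.toAddSubgroup.add_mem_cancel_right hl
    have e₂ : z + l + d ∈ L.lattice ↔ z + d ∈ L.lattice := by
      rw [add_right_comm]; exact L.lattice.toAddSubgroup.add_mem_cancel_right hl
    simp only [hg, e₁, e₂]
    split_ifs with h₁ h₂
    exacts [rfl, rfl, hp z h₁ h₂ l hl]
  have off : ∀ z, z ∉ L.lattice → z + d ∉ L.lattice → DifferentiableAt ℂ g z := by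
    intro z h₁ h₂
    refine (hf z h₁ h₂).congr_of_eventuallyEq ?_
    filter_upwards [L.isClosed_lattice.isOpen_compl.mem_nhds h₁,
      (isOpen_compl_latticeSub L d).mem_nhds h₂] with w hw₁ hw₂
    have hw₁' : w ∉ L.lattice := hw₁
    have hw₂' : w + d ∉ L.lattice := hw₂
    simp [hg, hw₁', hw₂']
  have ev : ∀ z, ∀ᶠ w in 𝓝[≠] z, w ∉ L.lattice ∧ w + d ∉ L.lattice := by
    intro z
    have h₁ : ∀ᶠ w in 𝓝[≠] z, w ∉ L.lattice := by
      filter_upwards [mem_nhdsWithin_of_mem_nhds (L.compl_lattice_sdiff_singleton_mem_nhds z),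
        self_mem_nhdsWithin] with w hw hw' h
      exact hw ⟨h, hw'⟩
    have h₂ : ∀ᶠ w in 𝓝[≠] z, w + d ∉ L.lattice := by
      have := (continuous_add_const d).continuousAt.preimage_mem_nhds
        (L.compl_lattice_sdiff_singleton_mem_nhds (z + d))
      filter_upwards [mem_nhdsWithin_of_mem_nhds this, self_mem_nhdsWithin] with w hw hw' h
      exact hw ⟨h, fun e ↦ hw' (by simpa using e)⟩
    exact h₁.and h₂
  have rem : ∀ z c, g z = c → Tendsto f (𝓝[≠] z) (𝓝 c) → DifferentiableAt ℂ g z := by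
    intro z c hc hlim
    refine (Complex.analyticAt_of_differentiable_on_punctured_nhds_of_continuousAt ?_
      ?_).differentiableAt
    · filter_upwards [ev z] with w hw using off w hw.1 hw.2
    · rw [continuousAt_iff_punctured_nhds, hc]
      refine hlim.congr' ?_
      filter_upwards [ev z] with w hw
      simp [hg, hw.1, hw.2]
  have d0 : DifferentiableAt ℂ g 0 := rem 0 a (by simp [hg]) ha
  have dd : DifferentiableAt ℂ g (-d) := rem (-d) b (by simp [hg, hd]) hb
  -- Periodicity transports the removable singularities at 0 and -d to all their lattice translates.
  have shift : ∀ z, ∀ l ∈ L.lattice, DifferentiableAt ℂ g z → DifferentiableAt ℂ g (z + l) := by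
    intro z l hl h
    have : g = fun w ↦ g (w - l) := by
      ext w; rw [sub_eq_add_neg, hgp w _ (neg_mem hl)]
    rw [this]
    have h' : DifferentiableAt ℂ g (z + l - l) := by simpa using h
    exact DifferentiableAt.comp (z + l) (f := fun w ↦ w - l) h' (by fun_prop)
  have hdiff : Differentiable ℂ g := by
    intro z
    by_cases h₁ : z ∈ L.lattice
    · simpa using shift 0 z h₁ d0
    by_cases h₂ : z + d ∈ L.lattice
    · simpa using shift (-d) (z + d) h₂ dd
    exact off z h₁ h₂
  have := periodic_const L hdiff hgp z 0
  simpa [hg, hz, hzd] using this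

end

/-! ### The zeta function and its quasi-periods -/

section

variable (L : PeriodPair)

/-- The regular part `ζ(z) - 1/z` of the zeta function at the origin. -/
noncomputable def zetaRegular (z : ℂ) : ℂ :=
  ∑' l : L.lattice, if (l : ℂ) = 0 then 0 else 1 / (z - (l : ℂ)) + 1 / (l : ℂ) + z / (l : ℂ) ^ 2

/-- The three terms combine to s²/(l²(s - l)), of order |l|⁻³, which is summable over a lattice of
rank two. -/
lemma zeta_term_bound {r : ℝ} (hr : 0 < r) {s : ℂ} (hs : ‖s‖ < r) {l : ℂ} (h : 2 * r ≤ ‖l‖) :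
    ‖1 / (s - l) + 1 / l + s / l ^ 2‖ ≤ 2 * r ^ 2 * ‖l‖ ^ (-3 : ℝ) := by
  have hl : 0 < ‖l‖ := by linarith
  have hl0 : l ≠ 0 := norm_pos_iff.mp hl
  have hsl : ‖l‖ / 2 ≤ ‖s - l‖ := by
    rw [norm_sub_rev]; exact .trans (by linarith) (norm_sub_norm_le l s)
  have hsl0 : s - l ≠ 0 := norm_pos_iff.mp (by linarith)
  have e : 1 / (s - l) + 1 / l + s / l ^ 2 = s ^ 2 / (l ^ 2 * (s - l)) := by
    field_simp; ring
  rw [e, norm_div, norm_mul, norm_pow, norm_pow]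
  calc ‖s‖ ^ 2 / (‖l‖ ^ 2 * ‖s - l‖) ≤ r ^ 2 / (‖l‖ ^ 2 * (‖l‖ / 2)) := by gcongr
    _ = 2 * r ^ 2 / ‖l‖ ^ 3 := by field_simp
    _ = _ := by norm_cast

lemma hasSumLocallyUniformly_zetaRegular :
    HasSumLocallyUniformly (fun (l : L.lattice) (z : ℂ) ↦
      if (l : ℂ) = 0 then 0 else 1 / (z - (l : ℂ)) + 1 / (l : ℂ) + z / (l : ℂ) ^ 2)
      (zetaRegular L) := by
  refine L.hasSumLocallyUniformly_aux (u := (2 * · ^ 2 * ‖·‖ ^ (-3 : ℝ))) _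
    (fun _ _ ↦ (ZLattice.summable_norm_rpow _ _ (by simp; norm_num)).mul_left _) fun r hr ↦
    Filter.eventually_atTop.mpr ⟨2 * r, ?_⟩
  rintro _ h s hs l rfl
  split_ifs
  · simpa using! show 0 ≤ 2 * r ^ 2 * (‖↑l‖ ^ 3)⁻¹ by positivity
  · exact zeta_term_bound hr hs h

lemma hasSum_zetaRegular (z : ℂ) :
    HasSum (fun l : L.lattice ↦
      if (l : ℂ) = 0 then 0 else 1 / (z - (l : ℂ)) + 1 / (l : ℂ) + z / (l : ℂ) ^ 2)
      (zetaRegular L z) :=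
  (hasSumLocallyUniformly_zetaRegular L).hasSum

lemma weierstrassZeta_eq (z : ℂ) : weierstrassZeta L z = 1 / z + zetaRegular L z := by
  have h₁ : HasSum (fun l : L.lattice ↦ if l = 0 then 1 / z else 0) (1 / z) := hasSum_ite_eq 0 _
  rw [weierstrassZeta, ← (h₁.add (hasSum_zetaRegular L z)).tsum_eq]
  congr with l
  by_cases hl : l = 0
  · simp [hl]
  · simp [hl]

lemma hasDerivAt_zeta_term {z l : ℂ} (h : z - l ≠ 0) :
    HasDerivAt (fun z ↦ 1 / (z - l) + 1 / l + z / l ^ 2) (-(1 / (z - l) ^ 2 - 1 / l ^ 2)) z := by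
  have h₁ := ((hasDerivAt_id z).sub_const l).fun_inv h
  have h₂ := (hasDerivAt_id z).div_const (l ^ 2)
  have := (h₁.add_const (1 / l)).add h₂
  refine (this.congr_deriv (by simp; ring)).congr_of_eventuallyEq (.of_forall fun w ↦ by simp)

lemma sub_ne_zero_of_mem {z : ℂ} (hz : z ∈ ((L.lattice : Set ℂ) \ {0})ᶜ) {l : L.lattice}
    (hl : (l : ℂ) ≠ 0) : z - l ≠ 0 := by
  intro e
  obtain rfl := sub_eq_zero.mp e
  exact hz ⟨l.2, hl⟩

/-- Termwise differentiation of a locally uniform limit of holomorphic sums. The term l = 0 is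
absent on both sides, so z = 0 is allowed; the expansion of G at its pole needs this. -/
lemma hasDerivAt_zetaRegular {z : ℂ} (hz : z ∈ ((L.lattice : Set ℂ) \ {0})ᶜ) :
    HasDerivAt (zetaRegular L) (-L.weierstrassPExcept 0 z) z := by
  have hd : ∀ s : Finset L.lattice, DifferentiableOn ℂ (fun z ↦ ∑ l ∈ s,
      if (l : ℂ) = 0 then 0 else 1 / (z - (l : ℂ)) + 1 / (l : ℂ) + z / (l : ℂ) ^ 2)
      ((L.lattice : Set ℂ) \ {0})ᶜ := by
    intro s
    refine .fun_sum fun l _ w hw ↦ ?_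
    split_ifs with hl
    · exact differentiableWithinAt_const _
    · exact (hasDerivAt_zeta_term
        (sub_ne_zero_of_mem L hw hl)).differentiableAt.differentiableWithinAt
  have hlim := (hasSumLocallyUniformly_zetaRegular L).tendstoLocallyUniformlyOn
    (s := ((L.lattice : Set ℂ) \ {0})ᶜ)
  have hdiff := (hlim.differentiableOn (.of_forall hd)
    L.isOpen_compl_lattice_sdiff).differentiableAt (L.isOpen_compl_lattice_sdiff.mem_nhds hz)
  have h₁ := (hlim.deriv (.of_forall hd) L.isOpen_compl_lattice_sdiff).tendsto_at hz
  have h₂ : Tendsto _ atTop (𝓝 _) := (L.hasSum_weierstrassPExcept 0 z).neg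
  refine hdiff.hasDerivAt.congr_deriv (tendsto_nhds_unique (h₁.congr fun s ↦ ?_) h₂)
  simp only [Function.comp_apply]
  rw [deriv_fun_sum]
  · refine Finset.sum_congr rfl fun l _ ↦ ?_
    split_ifs with hl
    · simp
    · exact (hasDerivAt_zeta_term (sub_ne_zero_of_mem L hz hl)).deriv
  · intro l _
    split_ifs with hl
    · simp
    · exact (hasDerivAt_zeta_term (sub_ne_zero_of_mem L hz hl)).differentiableAt

lemma ne_zero_of_notMem {z : ℂ} (hz : z ∉ L.lattice) : z ≠ 0 := by
  rintro rfl; exact hz (zero_mem _)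

lemma hasDerivAt_weierstrassZeta {z : ℂ} (hz : z ∉ L.lattice) :
    HasDerivAt (weierstrassZeta L) (-L.weierstrassP z) z := by
  have h0 := ne_zero_of_notMem L hz
  have h₁ := (hasDerivAt_inv h0).add
    (hasDerivAt_zetaRegular L (z := z) (fun h ↦ hz h.1))
  refine (h₁.congr_deriv ?_).congr_of_eventuallyEq (.of_forall fun w ↦ ?_)
  · have := L.weierstrassPExcept_add (0 : L.lattice) z
    simp only [ZeroMemClass.coe_zero, sub_zero] at this
    rw [← this]; simp
  · simp [weierstrassZeta_eq]

lemma weierstrassZeta_neg (z : ℂ) : weierstrassZeta L (-z) = -weierstrassZeta L z := by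
  simp only [weierstrassZeta]
  rw [← (Equiv.neg L.lattice).tsum_eq, ← tsum_neg]
  congr with l
  have : -z - -(l : ℂ) = -(z - l) := by ring
  simp only [Equiv.neg_apply, NegMemClass.coe_neg, this, one_div, inv_neg, neg_sq]
  ring

lemma add_mem_lattice_iff {z l : ℂ} (hl : l ∈ L.lattice) : z + l ∈ L.lattice ↔ z ∈ L.lattice :=
  L.lattice.toAddSubgroup.add_mem_cancel_right hl

lemma exists_quasiPeriod (l : ℂ) (hl : l ∈ L.lattice) :
    ∃ η : ℂ, ∀ z ∉ L.lattice, weierstrassZeta L (z + l) = weierstrassZeta L z + η := by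
  obtain ⟨c, hc⟩ := exists_const_of_hasDerivAt_zero (countable_lattice L) L.isClosed_lattice
    (f := fun z ↦ weierstrassZeta L (z + l) - weierstrassZeta L z) (fun z hz ↦ by
      have h₁ := (hasDerivAt_weierstrassZeta L
        ((add_mem_lattice_iff L hl (z := z)).not.mpr hz)).comp_add_const z l
      refine (h₁.sub (hasDerivAt_weierstrassZeta L hz)).congr_deriv ?_
      lift l to L.lattice using hl
      rw [L.weierstrassP_add_coe]; ring)
  exact ⟨c, fun z hz ↦ by rw [← hc z hz]; ring⟩

lemma weierstrassP_add {z l : ℂ} (hl : l ∈ L.lattice) :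
    L.weierstrassP (z + l) = L.weierstrassP z := L.weierstrassP_add_coe z ⟨l, hl⟩

/-! ### The addition theorem and the zeros of G -/

/-- `G(z, d) = ζ(z + d) - ζ(z) - ζ(d)`. -/
noncomputable def zetaDefect (z d : ℂ) : ℂ :=
  weierstrassZeta L (z + d) - weierstrassZeta L z - weierstrassZeta L d

lemma zetaDefect_comm (z d : ℂ) : zetaDefect L z d = zetaDefect L d z := by
  rw [zetaDefect, zetaDefect, add_comm z d]; ring

/-- By oddness of ζ. The reflection exchanges the poles 0 and -d, so local analysis at 0 suffices,
and it sends a zero c to the zero -d-c. -/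
lemma zetaDefect_reflect (z d : ℂ) : zetaDefect L (-d - z) d = zetaDefect L z d := by
  have e₁ : -d - z + d = -z := by ring
  have e₂ : -d - z = -(z + d) := by ring
  rw [zetaDefect, zetaDefect, e₁, e₂, weierstrassZeta_neg, weierstrassZeta_neg]; ring

variable {L}

lemma zetaDefect_add {z d l : ℂ} (hz : z ∉ L.lattice) (hzd : z + d ∉ L.lattice)
    (hl : l ∈ L.lattice) : zetaDefect L (z + l) d = zetaDefect L z d := by
  obtain ⟨η, h⟩ := exists_quasiPeriod L l hl
  rw [zetaDefect, zetaDefect, h z hz, add_right_comm, h _ hzd]; ring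

lemma hasDerivAt_zetaDefect {z d : ℂ} (hz : z ∉ L.lattice) (hzd : z + d ∉ L.lattice) :
    HasDerivAt (fun z ↦ zetaDefect L z d) (L.weierstrassP z - L.weierstrassP (z + d)) z := by
  have h₁ := (hasDerivAt_weierstrassZeta L hzd).comp_add_const z d
  exact ((h₁.sub (hasDerivAt_weierstrassZeta L hz)).sub_const _).congr_deriv (by ring)

/-- `G(z, d) + 1/z`, with its value `0` at `z = 0`. -/
noncomputable def zetaDefectRegular (L : PeriodPair) (d z : ℂ) : ℂ :=
  weierstrassZeta L (z + d) - zetaRegular L z - weierstrassZeta L d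

lemma zetaDefect_eq (d z : ℂ) : zetaDefect L z d = -1 / z + zetaDefectRegular L d z := by
  rw [zetaDefect, zetaDefectRegular, weierstrassZeta_eq L z]; ring

lemma zetaRegular_zero : zetaRegular L 0 = 0 := by
  rw [zetaRegular]
  convert tsum_zero with l
  split_ifs <;> simp

lemma zetaDefectRegular_zero (d : ℂ) : zetaDefectRegular L d 0 = 0 := by
  simp [zetaDefectRegular, zetaRegular_zero]

lemma hasDerivAt_zetaDefectRegular {d : ℂ} (hd : d ∉ L.lattice) :
    HasDerivAt (zetaDefectRegular L d) (-L.weierstrassP d) 0 := by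
  have h₁ := (hasDerivAt_weierstrassZeta L (z := 0 + d) (by simpa using hd)).comp_add_const 0 d
  have h₂ := hasDerivAt_zetaRegular L (z := 0) (by simp)
  refine ((h₁.sub h₂).sub_const (weierstrassZeta L d)).congr_deriv ?_
  simp

lemma tendsto_inv_zetaDefect {d : ℂ} (hd : d ∉ L.lattice) :
    Tendsto (fun z ↦ (zetaDefect L z d)⁻¹) (𝓝[≠] 0) (𝓝 0) := by
  have hc := (hasDerivAt_zetaDefectRegular hd).continuousAt
  have h₁ : ContinuousAt (fun z ↦ z / (-1 + z * zetaDefectRegular L d z)) 0 :=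
    continuousAt_id.div (continuousAt_const.add (continuousAt_id.mul hc)) (by simp)
  have h₂ : Tendsto (fun z ↦ z / (-1 + z * zetaDefectRegular L d z)) (𝓝[≠] 0) (𝓝 0) := by
    simpa using h₁.tendsto.mono_left nhdsWithin_le_nhds
  refine h₂.congr' ?_
  filter_upwards [self_mem_nhdsWithin] with z hz
  have hz : z ≠ 0 := hz
  rw [zetaDefect_eq, ← inv_div]
  congr 1
  field_simp

lemma tendsto_reflect (d : ℂ) : Tendsto (fun z : ℂ ↦ -d - z) (𝓝[≠] (-d)) (𝓝[≠] 0) := by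
  refine tendsto_nhdsWithin_iff.mpr ⟨?_, ?_⟩
  · have : ContinuousAt (fun z : ℂ ↦ -d - z) (-d) := by fun_prop
    simpa using this.tendsto.mono_left (nhdsWithin_le_nhds (s := {-d}ᶜ))
  · filter_upwards [self_mem_nhdsWithin] with z hz h
    exact hz (by simpa [sub_eq_zero, eq_comm] using h)

lemma continuousAt_weierstrassP {z : ℂ} (hz : z ∉ L.lattice) : ContinuousAt L.weierstrassP z :=
  (hasDerivAt_weierstrassP L hz).continuousAt

/-- The difference H of the two sides is elliptic. At 0, G = -1/z - ℘(d)z + o(z), so G² = 1/z² +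
2℘(d) + o(1) and H tends to 0; reflection gives the same at -d, and Liouville gives H = 0. -/
theorem zetaDefect_sq {z d : ℂ} (hd : d ∉ L.lattice) (hz : z ∉ L.lattice)
    (hzd : z + d ∉ L.lattice) :
    zetaDefect L z d ^ 2 = L.weierstrassP z + L.weierstrassP (z + d) + L.weierstrassP d := by
  set H : ℂ → ℂ := fun z ↦
    zetaDefect L z d ^ 2 - L.weierstrassP z - L.weierstrassP (z + d) - L.weierstrassP d with hH
  have h0 : Tendsto H (𝓝[≠] 0) (𝓝 0) := by
    have hg := hasDerivAt_zetaDefectRegular hd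
    have hslope := hasDerivAt_iff_tendsto_slope.mp hg
    have hex : ContinuousAt (L.weierstrassPExcept 0) 0 :=
      ((L.differentiableOn_weierstrassPExcept 0).differentiableAt
        (L.compl_lattice_sdiff_singleton_mem_nhds 0)).continuousAt
    have hP : ContinuousAt (fun z ↦ L.weierstrassP (z + d)) 0 :=
      ContinuousAt.comp' (x := 0) (f := fun z ↦ z + d)
        (continuousAt_weierstrassP (by simpa using hd)) (by fun_prop)
    have hc : ContinuousAt (fun z ↦ zetaDefectRegular L d z ^ 2 - L.weierstrassPExcept 0 z
        - L.weierstrassP (z + d) - L.weierstrassP d) 0 :=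
      (((hg.continuousAt.pow 2).sub hex).sub hP).sub continuousAt_const
    -- Once the 1/z² terms cancel, the cross term of G² is -2 times the slope at 0 of the regular
    -- part, with limit 2℘(d).
    have := (hc.tendsto.mono_left (nhdsWithin_le_nhds (s := {0}ᶜ))).sub (hslope.const_mul 2)
    rw [zetaDefectRegular_zero, L.weierstrassPExcept_zero, zero_add, show (0 : ℂ) ^ 2 - 0
      - L.weierstrassP d - L.weierstrassP d - 2 * -L.weierstrassP d = 0 by ring] at this
    refine this.congr' ?_
    filter_upwards [self_mem_nhdsWithin] with w hw
    have hw : w ≠ 0 := hw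
    have e := L.weierstrassPExcept_add (0 : L.lattice) w
    simp only [ZeroMemClass.coe_zero, sub_zero] at e
    simp only [hH, zetaDefect_eq, ← e, slope_def_field, zetaDefectRegular_zero, sub_zero]
    field_simp
    ring
  have hd' : Tendsto H (𝓝[≠] (-d)) (𝓝 0) := by
    refine (h0.comp (tendsto_reflect d)).congr fun w ↦ ?_
    have e₁ : -d - w + d = -w := by ring
    have e₂ : -d - w = -(w + d) := by ring
    simp only [hH, Function.comp_apply, zetaDefect_reflect, e₁]
    rw [e₂, L.weierstrassP_neg, L.weierstrassP_neg]; ring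
  have key : H z = 0 := by
    refine eq_of_elliptic L hd (fun w hw hwd ↦ ?_) (fun w hw hwd l hl ↦ ?_) h0 hd' hz hzd
    · have h₁ := (hasDerivAt_zetaDefect hw hwd).differentiableAt
      have h₂ := (hasDerivAt_weierstrassP L hw).differentiableAt
      have h₃ := ((hasDerivAt_weierstrassP L hwd).comp_add_const w d).differentiableAt
      exact (((h₁.pow 2).sub h₂).sub h₃).sub_const _
    · simp only [hH]
      rw [zetaDefect_add hw hwd hl, weierstrassP_add L hl, add_right_comm, weierstrassP_add L hl]
  simp only [hH] at key
  linear_combination key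

/-- At 0, ℘(z) has a double pole while ℘(z+d) is regular; multiplying by z² would give 1 = 0 in the
limit. -/
lemma not_forall_weierstrassP_add_eq (d : ℂ) (hd : d ∉ L.lattice) :
    ∃ z, z ∉ L.lattice ∧ z + d ∉ L.lattice ∧ L.weierstrassP z ≠ L.weierstrassP (z + d) := by
  by_contra! h
  have hc : ContinuousAt (fun z ↦ L.weierstrassP (z + d)) 0 :=
      ContinuousAt.comp' (x := 0) (f := fun z ↦ z + d)
        (continuousAt_weierstrassP (by simpa using hd)) (by fun_prop)
  have hex : ContinuousAt (L.weierstrassPExcept 0) 0 :=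
    ((L.differentiableOn_weierstrassPExcept 0).differentiableAt
      (L.compl_lattice_sdiff_singleton_mem_nhds 0)).continuousAt
  have hlim : Tendsto (fun z ↦ z ^ 2 * (L.weierstrassP (z + d) - L.weierstrassPExcept 0 z))
      (𝓝[≠] 0) (𝓝 0) := by
    have : ContinuousAt (fun z ↦ z ^ 2 * (L.weierstrassP (z + d) - L.weierstrassPExcept 0 z)) 0 :=
      (continuousAt_id.pow 2).mul (hc.sub hex)
    simpa using this.tendsto.mono_left (nhdsWithin_le_nhds (s := {0}ᶜ))
  refine one_ne_zero (α := ℂ) (tendsto_nhds_unique (tendsto_const_nhds.congr' ?_) hlim)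
  filter_upwards [self_mem_nhdsWithin,
    mem_nhdsWithin_of_mem_nhds (L.compl_lattice_sdiff_singleton_mem_nhds 0),
    mem_nhdsWithin_of_mem_nhds ((isOpen_compl_latticeSub L d).mem_nhds
      (show (0 : ℂ) ∉ latticeSub L d by simpa using hd))] with z hz hz' hzd
  have hz : z ≠ 0 := hz
  have e := L.weierstrassPExcept_add (0 : L.lattice) z
  simp only [ZeroMemClass.coe_zero, sub_zero] at e
  rw [← h z (fun H ↦ hz' ⟨H, hz⟩) hzd, ← e]
  field_simp
  simp

/-- Otherwise 1/G would be elliptic without poles and tend to 0 at 0, hence vanish identically,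
which is absurd. -/
lemma exists_zetaDefect_eq_zero {d : ℂ} (hd : d ∉ L.lattice) :
    ∃ z, z ∉ L.lattice ∧ z + d ∉ L.lattice ∧ zetaDefect L z d = 0 := by
  by_contra! h
  have h0 := tendsto_inv_zetaDefect hd
  have hd' : Tendsto (fun z ↦ (zetaDefect L z d)⁻¹) (𝓝[≠] (-d)) (𝓝 0) :=
    (h0.comp (tendsto_reflect d)).congr fun w ↦ by
      simp only [Function.comp_apply, zetaDefect_reflect]
  obtain ⟨z, hz, hzd, -⟩ := not_forall_weierstrassP_add_eq d hd
  refine h z hz hzd (inv_eq_zero.mp ?_)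
  refine eq_of_elliptic L hd (f := fun z ↦ (zetaDefect L z d)⁻¹) (fun w hw hwd ↦ ?_)
    (fun w hw hwd l hl ↦ ?_) h0 hd' hz hzd
  · exact (hasDerivAt_zetaDefect hw hwd).differentiableAt.inv (h w hw hwd)
  · simp only [zetaDefect_add hw hwd hl]

/-- Differentiate ℘'² = 4℘³ - g₂℘ - g₃ and divide by 2℘'. The zeros of ℘' are countable because ℘ is
not constant, and continuity covers them. -/
lemma hasDerivAt_derivWeierstrassP {z : ℂ} (hz : z ∉ L.lattice) :
    HasDerivAt L.derivWeierstrassP (6 * L.weierstrassP z ^ 2 - L.g₂ / 2) z := by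
  have hd : ∀ w, w ∉ L.lattice → HasDerivAt L.derivWeierstrassP (deriv L.derivWeierstrassP w) w :=
    fun w hw ↦ (L.analyticOnNhd_derivWeierstrassP w hw).differentiableAt.hasDerivAt
  obtain ⟨z₀, hz₀, hz₀'⟩ : ∃ z₀ ∈ (L.lattice : Set ℂ)ᶜ, L.derivWeierstrassP z₀ ≠ 0 := by
    by_contra! h
    obtain ⟨c, hc⟩ := exists_const_of_hasDerivAt_zero (countable_lattice L) L.isClosed_lattice
      (f := L.weierstrassP) (fun z hz ↦ (hasDerivAt_weierstrassP L hz).congr_deriv (h z hz))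
    obtain ⟨z, hz, hzd, hne⟩ := not_forall_weierstrassP_add_eq _ L.ω₁_div_two_notMem_lattice
    exact hne (by rw [hc z hz, hc _ hzd])
  have hcount := countable_zeros L.analyticOnNhd_derivWeierstrassP
    (isPreconnected_compl (countable_lattice L)) hz₀ hz₀'
  refine (hd z hz).congr_deriv ?_
  refine eqOn_of_eq_off_countable L.isClosed_lattice.isOpen_compl hcount
    (L.analyticOnNhd_derivWeierstrassP.deriv.continuousOn)
    (g := fun z ↦ 6 * L.weierstrassP z ^ 2 - L.g₂ / 2) ?_ (fun w hw hw' ↦ ?_) hz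
  · have := L.analyticOnNhd_weierstrassP.continuousOn
    fun_prop
  · have hw : w ∉ L.lattice := hw
    have hne : L.derivWeierstrassP w ≠ 0 := fun h ↦ hw' ⟨hw, h⟩
    have hP := hasDerivAt_weierstrassP L hw
    have h₁ := (hd w hw).fun_pow 2
    have h₂ := ((((hP.fun_pow 3).const_mul 4).sub (hP.const_mul L.g₂)).sub_const L.g₃)
    have h₃ := h₁.unique (h₂.congr_of_eventuallyEq (by
      filter_upwards [L.isClosed_lattice.isOpen_compl.mem_nhds hw] with v hv
      exact L.derivWeierstrassP_sq v hv))
    apply mul_left_cancel₀ hne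
    push_cast at h₃
    linear_combination h₃ / 2

/-- Differentiating the addition theorem `G² = ℘(z) + ℘(z + d) + ℘(d)`. -/
lemma two_mul_zetaDefect_mul {z d : ℂ} (hd : d ∉ L.lattice) (hz : z ∉ L.lattice)
    (hzd : z + d ∉ L.lattice) :
    2 * zetaDefect L z d * (L.weierstrassP z - L.weierstrassP (z + d))
      = L.derivWeierstrassP z + L.derivWeierstrassP (z + d) := by
  have h₁ := (hasDerivAt_zetaDefect hz hzd).fun_pow 2
  have h₂ := ((hasDerivAt_weierstrassP L hz).add
    ((hasDerivAt_weierstrassP L hzd).comp_add_const z d)).add_const (L.weierstrassP d)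
  have h₃ := h₁.unique (h₂.congr_of_eventuallyEq (by
    filter_upwards [L.isClosed_lattice.isOpen_compl.mem_nhds hz,
      (isOpen_compl_latticeSub L d).mem_nhds hzd] with v hv hvd
    exact zetaDefect_sq hd hv hvd))
  push_cast at h₃
  linear_combination h₃

/-- Differentiating `two_mul_zetaDefect_mul` at a zero of G gives 2(℘(z) - ℘(z+d))² = 6℘(z)² +
6℘(z+d)² - g₂. The addition theorem supplies the sum -℘(d), which leaves the product. -/
lemma weierstrassP_mul_of_zetaDefect_eq_zero {z d : ℂ} (hd : d ∉ L.lattice) (hz : z ∉ L.lattice)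
    (hzd : z + d ∉ L.lattice) (h : zetaDefect L z d = 0) :
    L.weierstrassP z * L.weierstrassP (z + d) = L.weierstrassP d ^ 2 - L.g₂ / 4 := by
  have hP := hasDerivAt_weierstrassP L hz
  have hPd := (hasDerivAt_weierstrassP L hzd).comp_add_const z d
  have h₁ := ((hasDerivAt_zetaDefect hz hzd).const_mul 2).mul (hP.sub hPd)
  have h₂ := (hasDerivAt_derivWeierstrassP hz).add
    ((hasDerivAt_derivWeierstrassP hzd).comp_add_const z d)
  have h₃ := h₁.unique (h₂.congr_of_eventuallyEq (by
    filter_upwards [L.isClosed_lattice.isOpen_compl.mem_nhds hz,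
      (isOpen_compl_latticeSub L d).mem_nhds hzd] with v hv hvd
    exact two_mul_zetaDefect_mul hd hv hvd))
  have hs := zetaDefect_sq hd hz hzd
  simp only [h] at h₃ hs
  simp only [mul_zero, zero_mul, add_zero, Pi.sub_apply] at h₃
  have hs' : L.weierstrassP z + L.weierstrassP (z + d) = -L.weierstrassP d := by
    linear_combination -hs
  linear_combination h₃ / 4 + (L.weierstrassP z + L.weierstrassP (z + d)
    - L.weierstrassP d) * hs'

end

/-! ### The sigma function and the factorization of G -/

section

/-- The elementary factor `(1 - w) exp(w + w²/2)` of genus two. -/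
noncomputable def primaryFactor (w : ℂ) : ℂ := (1 - w) * Complex.exp (w + w ^ 2 / 2)

lemma hasDerivAt_primaryFactor (w : ℂ) :
    HasDerivAt primaryFactor (-w ^ 2 * Complex.exp (w + w ^ 2 / 2)) w := by
  have h₁ := (hasDerivAt_id w).const_sub 1
  have h₂ := ((hasDerivAt_id w).add (((hasDerivAt_id w).fun_pow 2).div_const 2)).cexp
  refine (h₁.mul h₂).congr_deriv ?_
  simp
  ring

/-- The derivative is -w² exp(w + w²/2), since the lower orders cancel; the mean value inequality
adds one more power of |w|. Cubic decay makes the sigma product converge. -/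
lemma norm_primaryFactor_sub_one_le {w : ℂ} (hw : ‖w‖ ≤ 1) :
    ‖primaryFactor w - 1‖ ≤ Real.exp 2 * ‖w‖ ^ 3 := by
  have := (convex_closedBall (0 : ℂ) ‖w‖).norm_image_sub_le_of_norm_hasDerivWithin_le
    (f := primaryFactor) (f' := fun z ↦ -z ^ 2 * Complex.exp (z + z ^ 2 / 2))
    (C := ‖w‖ ^ 2 * Real.exp 2) (x := 0) (y := w)
    (fun z _ ↦ (hasDerivAt_primaryFactor z).hasDerivWithinAt) (fun z hz ↦ ?_) (by simp) (by simp)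
  · simp only [primaryFactor, sub_zero] at this ⊢
    simp only [one_mul, ne_eq, OfNat.ofNat_ne_zero, not_false_eq_true, zero_pow,
      zero_div, add_zero, Complex.exp_zero] at this
    linarith
  · have hz : ‖z‖ ≤ ‖w‖ := by simpa using hz
    have hz1 := hz.trans hw
    rw [norm_mul, norm_neg, norm_pow, Complex.norm_exp]
    gcongr
    calc (z + z ^ 2 / 2).re ≤ ‖z + z ^ 2 / 2‖ := Complex.re_le_norm _
      _ ≤ ‖z‖ + ‖z‖ ^ 2 / 2 := by
        refine (norm_add_le _ _).trans ?_
        simp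
      _ ≤ 2 := by nlinarith [norm_nonneg z]

variable (L : PeriodPair)

/-- The factor of the sigma product that belongs to `l`, with value `1` for `l = 0`. -/
noncomputable def sigmaFactor (l : L.lattice) (z : ℂ) : ℂ :=
  (1 - z / (l : ℂ)) * Complex.exp (z / (l : ℂ) + z ^ 2 / (2 * (l : ℂ) ^ 2))

lemma sigmaFactor_eq (l : L.lattice) (z : ℂ) : sigmaFactor L l z = primaryFactor (z / l) := by
  rw [sigmaFactor, primaryFactor]
  congr 3
  rw [div_pow, div_div, mul_comm]

lemma differentiable_sigmaFactor (l : L.lattice) : Differentiable ℂ (sigmaFactor L l) := by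
  unfold sigmaFactor
  simp only [div_eq_mul_inv]
  fun_prop

lemma sigmaFactor_ne_zero (l : L.lattice) {z : ℂ} (hz : z ∉ L.lattice) :
    sigmaFactor L l z ≠ 0 := by
  refine mul_ne_zero (fun h ↦ ?_) (Complex.exp_ne_zero _)
  rcases eq_or_ne (l : ℂ) 0 with hl | hl
  · simp [hl] at h
  · have : z = l := by field_simp at h; linear_combination -h
    exact hz (this ▸ l.2)

lemma eventually_sigmaFactor_bound (r : ℝ) : ∀ᶠ l : L.lattice in cofinite,
    ∀ z ∈ Metric.ball (0 : ℂ) r, ‖sigmaFactor L l z - 1‖ ≤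
      Real.exp 2 * r ^ 3 * ‖l‖ ^ (-3 : ℝ) := by
  refine (isCompact_iff_finite.mp (isCompact_closedBall (0 : L.lattice) |r|)).subset ?_
  intro l hl
  simp only [Metric.mem_closedBall, dist_zero_right]
  by_contra! hlt
  refine hl fun z hz ↦ ?_
  have hz : ‖z‖ < r := by simpa using hz
  have hr : 0 < r := (norm_nonneg z).trans_lt hz
  have hl0 : r < ‖(l : ℂ)‖ := (le_abs_self r).trans_lt hlt
  have hl1 : 0 < ‖(l : ℂ)‖ := hr.trans hl0
  rw [sigmaFactor_eq]
  refine (norm_primaryFactor_sub_one_le ?_).trans ?_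
  · rw [norm_div, div_le_one hl1]; linarith
  · rw [norm_div, div_pow, mul_assoc, div_eq_mul_inv]
    have e : ‖l‖ ^ (-3 : ℝ) = (‖(l : ℂ)‖ ^ 3)⁻¹ := by
      rw [Real.rpow_neg (norm_nonneg _)]; norm_cast
    rw [e]
    gcongr

lemma summable_sigmaFactor_bound (r : ℝ) :
    Summable fun l : L.lattice ↦ Real.exp 2 * r ^ 3 * ‖l‖ ^ (-3 : ℝ) :=
  (ZLattice.summable_norm_rpow _ _ (by simp; norm_num)).mul_left _

lemma hasProdLocallyUniformlyOn_sigmaFactor (r : ℝ) :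
    HasProdLocallyUniformlyOn (sigmaFactor L) (fun z ↦ ∏' l, sigmaFactor L l z)
      (Metric.ball (0 : ℂ) r) := by
  have := Summable.hasProdLocallyUniformlyOn_one_add (f := fun l z ↦ sigmaFactor L l z - 1)
    Metric.isOpen_ball (summable_sigmaFactor_bound L r) (eventually_sigmaFactor_bound L r)
    (fun l ↦ ((differentiable_sigmaFactor L l).continuous.sub continuous_const).continuousOn)
  simpa using this

/-- The product `σ(z)/z`. -/
noncomputable def sigmaProd (z : ℂ) : ℂ := ∏' l : L.lattice, sigmaFactor L l z

lemma weierstrassSigma_eq (z : ℂ) : weierstrassSigma L z = z * sigmaProd L z := rfl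

lemma differentiable_sigmaProd : Differentiable ℂ (sigmaProd L) := by
  intro z
  have h : TendstoLocallyUniformlyOn _ (sigmaProd L) atTop (Metric.ball (0 : ℂ) (‖z‖ + 1)) :=
    hasProdLocallyUniformlyOn_sigmaFactor L (‖z‖ + 1)
  refine (h.differentiableOn (.of_forall fun s ↦ ?_)
    Metric.isOpen_ball).differentiableAt (Metric.isOpen_ball.mem_nhds (by simp))
  exact .fun_finsetProd fun l _ ↦ (differentiable_sigmaFactor L l).differentiableOn

lemma sigmaProd_ne_zero {z : ℂ} (hz : z ∉ L.lattice) : sigmaProd L z ≠ 0 := by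
  have := tprod_one_add_ne_zero_of_summable (f := fun l : L.lattice ↦ sigmaFactor L l z - 1)
    (fun l ↦ by simpa using sigmaFactor_ne_zero L l hz) ?_
  · simpa [sigmaProd] using this
  · refine (summable_sigmaFactor_bound L (‖z‖ + 1)).of_norm_bounded_eventually ?_
    filter_upwards [eventually_sigmaFactor_bound L (‖z‖ + 1)] with l hl
    simpa using hl z (by simp)

lemma logDeriv_sigmaFactor (l : L.lattice) {z : ℂ} (hz : z ∉ L.lattice) :
    logDeriv (sigmaFactor L l) z =
      if (l : ℂ) = 0 then 0 else 1 / (z - (l : ℂ)) + 1 / (l : ℂ) + z / (l : ℂ) ^ 2 := by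
  have h := (hasDerivAt_primaryFactor (z / l)).comp z ((hasDerivAt_id z).div_const (l : ℂ))
  rw [logDeriv_apply, (h.congr_of_eventuallyEq (.of_forall (sigmaFactor_eq L l))).deriv,
    sigmaFactor_eq, primaryFactor]
  split_ifs with hl
  · simp [hl]
  · have hzl : z - l ≠ 0 := fun e ↦ hz (by rw [sub_eq_zero.mp e]; exact l.2)
    have hzl' : (l : ℂ) - z ≠ 0 := fun e ↦ hzl (by linear_combination -e)
    have h1 : 1 - z / l ≠ 0 := by rw [one_sub_div hl]; exact div_ne_zero hzl' hl
    have := Complex.exp_ne_zero (z / l + (z / l) ^ 2 / 2)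
    field_simp
    ring

/-- Logarithmic differentiation of the product, factor by factor; with the factor z this gives σ' =
ζσ. -/
lemma logDeriv_sigmaProd {z : ℂ} (hz : z ∉ L.lattice) :
    logDeriv (sigmaProd L) z = zetaRegular L z := by
  have := logDeriv_tprod_eq_tsum (f := sigmaFactor L) Metric.isOpen_ball
    (x := z) (s := Metric.ball 0 (‖z‖ + 1)) (by simp) (fun l ↦ sigmaFactor_ne_zero L l hz)
    (fun l ↦ (differentiable_sigmaFactor L l).differentiableOn) ?_
    ⟨_, hasProdLocallyUniformlyOn_sigmaFactor L _⟩ (sigmaProd_ne_zero L hz)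
  · simp only [logDeriv_sigmaFactor L _ hz] at this
    exact this
  · simp only [logDeriv_sigmaFactor L _ hz]
    exact (hasSum_zetaRegular L z).summable

lemma differentiable_weierstrassSigma : Differentiable ℂ (weierstrassSigma L) :=
  differentiable_id.mul (differentiable_sigmaProd L)

lemma weierstrassSigma_ne_zero {z : ℂ} (hz : z ∉ L.lattice) : weierstrassSigma L z ≠ 0 :=
  mul_ne_zero (ne_zero_of_notMem L hz) (sigmaProd_ne_zero L hz)

lemma weierstrassSigma_zero : weierstrassSigma L 0 = 0 := by simp [weierstrassSigma]

lemma hasDerivAt_weierstrassSigma {z : ℂ} (hz : z ∉ L.lattice) :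
    HasDerivAt (weierstrassSigma L) (weierstrassZeta L z * weierstrassSigma L z) z := by
  have h0 := ne_zero_of_notMem L hz
  have hp := sigmaProd_ne_zero L hz
  have h := logDeriv_sigmaProd L hz
  rw [logDeriv_apply, div_eq_iff hp] at h
  have h₁ := (differentiable_sigmaProd L z).hasDerivAt
  rw [h] at h₁
  refine ((hasDerivAt_id z).mul h₁).congr_deriv ?_
  rw [weierstrassZeta_eq, weierstrassSigma_eq]
  simp
  field_simp

lemma weierstrassSigma_neg (z : ℂ) : weierstrassSigma L (-z) = -weierstrassSigma L z := by
  have : sigmaProd L (-z) = sigmaProd L z := by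
    rw [sigmaProd, sigmaProd, ← (Equiv.neg L.lattice).tprod_eq]
    congr with l
    simp [sigmaFactor_eq]
  rw [weierstrassSigma_eq, weierstrassSigma_eq, this]; ring

variable {L}

lemma hasDerivAt_sigma_add {z c : ℂ} (h : z + c ∉ L.lattice) :
    HasDerivAt (fun z ↦ weierstrassSigma L (z + c))
      (weierstrassZeta L (z + c) * weierstrassSigma L (z + c)) z :=
  (hasDerivAt_weierstrassSigma L h).comp_add_const z c

lemma hasDerivAt_sigma_sub {z c : ℂ} (h : z - c ∉ L.lattice) :
    HasDerivAt (fun z ↦ weierstrassSigma L (z - c))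
      (weierstrassZeta L (z - c) * weierstrassSigma L (z - c)) z :=
  (hasDerivAt_weierstrassSigma L h).comp_sub_const z c

/-- The quasi-periodicity of `ζ` and `σ`. -/
lemma exists_quasiPeriods {l : ℂ} (hl : l ∈ L.lattice) : ∃ η s : ℂ, s ≠ 0 ∧
    (∀ z ∉ L.lattice, weierstrassZeta L (z + l) = weierstrassZeta L z + η) ∧
    ∀ z, weierstrassSigma L (z + l) = s * Complex.exp (η * z) * weierstrassSigma L z := by
  obtain ⟨η, hη⟩ := exists_quasiPeriod L l hl
  -- This quotient has logarithmic derivative ζ(z+l) - η - ζ(z) = 0.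
  obtain ⟨s, hs⟩ := exists_const_of_hasDerivAt_zero (countable_lattice L) L.isClosed_lattice
    (f := fun z ↦ weierstrassSigma L (z + l) * Complex.exp (-η * z) / weierstrassSigma L z)
    (fun z hz ↦ by
      have hzl : z + l ∉ L.lattice := (add_mem_lattice_iff L hl).not.mpr hz
      have hσ := weierstrassSigma_ne_zero L hz
      have h₁ := (hasDerivAt_sigma_add hzl).mul ((hasDerivAt_id z).const_mul (-η)).cexp
      refine (h₁.div (hasDerivAt_weierstrassSigma L hz) hσ).congr_deriv ?_
      rw [hη z hz]
      refine div_eq_zero_iff.mpr (.inl ?_)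
      simp
      ring)
  have key : ∀ z ∉ L.lattice,
      weierstrassSigma L (z + l) = s * Complex.exp (η * z) * weierstrassSigma L z := by
    intro z hz
    have hσ := weierstrassSigma_ne_zero L hz
    rw [← hs z hz, neg_mul, Complex.exp_neg]
    have := Complex.exp_ne_zero (η * z)
    field_simp
  refine ⟨η, s, ?_, hη, fun z ↦ ?_⟩
  · rintro rfl
    have h := key _ L.ω₁_div_two_notMem_lattice
    simp only [zero_mul] at h
    exact weierstrassSigma_ne_zero L
      ((add_mem_lattice_iff L hl).not.mpr L.ω₁_div_two_notMem_lattice) h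
  · have hσ := (differentiable_weierstrassSigma L).continuous
    exact eqOn_of_eq_off_countable isOpen_univ (countable_lattice L)
      (f := fun z ↦ weierstrassSigma L (z + l))
      (g := fun z ↦ s * Complex.exp (η * z) * weierstrassSigma L z)
      (by fun_prop) (by fun_prop) (fun z _ hz ↦ key z hz) (mem_univ z)

/-- Polarization: with A = G(z,-c) and B = G(z,d), the condition G(c,d) = 0 makes B - A =
G(z-c,c+d). The addition theorem then evaluates all three squares in 2AB = A² + B² - (B-A)². -/
lemma zetaDefect_mul_zetaDefect {c d z : ℂ} (hd : d ∉ L.lattice) (hc : c ∉ L.lattice)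
    (hcd : c + d ∉ L.lattice) (h : zetaDefect L c d = 0)
    (hz : z ∉ L.lattice) (hzc : z - c ∉ L.lattice) (hzd : z + d ∉ L.lattice) :
    zetaDefect L z (-c) * zetaDefect L z d =
      L.weierstrassP z + L.weierstrassP c + L.weierstrassP d := by
  have hA := zetaDefect_sq (z := z) (d := -c) (neg_mem_iff.not.mpr hc) hz
    (by rwa [← sub_eq_add_neg])
  have hB := zetaDefect_sq hd hz hzd
  have e : z - c + (c + d) = z + d := by ring
  have hAB := zetaDefect_sq (z := z - c) hcd hzc (by rwa [e])
  have h0 := zetaDefect_sq hd hc hcd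
  have hdiff : zetaDefect L (z - c) (c + d) = zetaDefect L z d - zetaDefect L z (-c) := by
    simp only [zetaDefect] at h ⊢
    rw [e, weierstrassZeta_neg, ← sub_eq_add_neg]
    linear_combination -h
  rw [hdiff, e] at hAB
  rw [h] at h0
  rw [← sub_eq_add_neg, L.weierstrassP_neg] at hA
  linear_combination (hA + hB - hAB + h0) / 2

/-- The logarithmic derivative of `G(·, d)` when `G(c, d) = 0`. -/
lemma zetaDefect_mul_add {c d z : ℂ} (hd : d ∉ L.lattice) (hc : c ∉ L.lattice)
    (hcd : c + d ∉ L.lattice) (h : zetaDefect L c d = 0) (hz : z ∉ L.lattice)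
    (hzc : z - c ∉ L.lattice) (hzd : z + d ∉ L.lattice) (hzdc : z + d + c ∉ L.lattice) :
    zetaDefect L z d * (zetaDefect L z (-c) + zetaDefect L (z + d) c) =
      L.weierstrassP z - L.weierstrassP (z + d) := by
  have h₁ := zetaDefect_mul_zetaDefect hd hc hcd h hz hzc hzd
  -- The same product formula at z + d with c and d exchanged; its first factor G(z+d,-d) equals
  -- -G(z,d).
  have h₂ := zetaDefect_mul_zetaDefect (z := z + d) hc hd (by rwa [add_comm])
    (by rwa [zetaDefect_comm]) hzd (by simpa using hz) hzdc
  have e : zetaDefect L (z + d) (-d) = -zetaDefect L z d := by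
    simp only [zetaDefect, weierstrassZeta_neg, add_neg_cancel_right]; ring
  rw [e] at h₂
  linear_combination h₁ - h₂

/-- `ζ(z + d) - ζ(z) - ζ(d)` as a sigma quotient. -/
lemma exists_zetaDefect_factorization {c d : ℂ} (hd : d ∉ L.lattice) (hc : c ∉ L.lattice)
    (hcd : c + d ∉ L.lattice) (h : zetaDefect L c d = 0) :
    ∃ C ≠ 0, ∀ z, z ∉ L.lattice → z + d ∉ L.lattice →
      zetaDefect L z d * (weierstrassSigma L z * weierstrassSigma L (z + d)) =
        C * (weierstrassSigma L (z - c) * weierstrassSigma L (z + d + c)) := by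
  set T := (((L.lattice : Set ℂ) ∪ latticeSub L d) ∪ latticeSub L (-c)) ∪ latticeSub L (d + c)
    with hT
  have hTc : T.Countable := (((countable_lattice L).union (countable_latticeSub L d)).union
    (countable_latticeSub L (-c))).union (countable_latticeSub L (d + c))
  have hTcl : IsClosed T := ((L.isClosed_lattice.union (isClosed_latticeSub L d)).union
    (isClosed_latticeSub L (-c))).union (isClosed_latticeSub L (d + c))
  have hmem : ∀ z ∉ T, z ∉ L.lattice ∧ z + d ∉ L.lattice ∧ z - c ∉ L.lattice ∧
      z + d + c ∉ L.lattice := by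
    intro z hz
    simpa [hT, and_assoc, ← sub_eq_add_neg, ← add_assoc] using hz
  obtain ⟨C, hC⟩ := exists_const_of_hasDerivAt_zero hTc hTcl (f := fun z ↦ zetaDefect L z d *
    (weierstrassSigma L z * weierstrassSigma L (z + d)) /
    (weierstrassSigma L (z - c) * weierstrassSigma L (z + d + c))) (fun z hz ↦ by
      obtain ⟨hz, hzd, hzc, hzdc⟩ := hmem z hz
      have hσ₁ := weierstrassSigma_ne_zero L hzc
      have hσ₂ := weierstrassSigma_ne_zero L hzdc
      have hnum := (hasDerivAt_zetaDefect hz hzd).mul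
        ((hasDerivAt_weierstrassSigma L hz).mul (hasDerivAt_sigma_add hzd))
      have h₄ : HasDerivAt (fun z ↦ weierstrassSigma L (z + d + c)) _ z :=
        (hasDerivAt_sigma_add (z := z + d) hzdc).comp_add_const z d
      have hden := (hasDerivAt_sigma_sub hzc).mul h₄
      refine (hnum.div hden (mul_ne_zero hσ₁ hσ₂)).congr_deriv ?_
      refine div_eq_zero_iff.mpr (.inl ?_)
      have key := zetaDefect_mul_add hd hc hcd h hz hzc hzd hzdc
      simp only [Pi.mul_apply]
      rw [← key]
      simp only [zetaDefect, weierstrassZeta_neg, ← sub_eq_add_neg]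
      ring)
  have key : ∀ z, z ∉ L.lattice → z + d ∉ L.lattice →
      zetaDefect L z d * (weierstrassSigma L z * weierstrassSigma L (z + d)) =
        C * (weierstrassSigma L (z - c) * weierstrassSigma L (z + d + c)) := by
    intro z hz hzd
    have hσ := (differentiable_weierstrassSigma L).continuous
    have hU : IsOpen ((L.lattice : Set ℂ)ᶜ ∩ (latticeSub L d)ᶜ) :=
      L.isClosed_lattice.isOpen_compl.inter (isOpen_compl_latticeSub L d)
    refine eqOn_of_eq_off_countable hU hTc (f := fun z ↦
      zetaDefect L z d * (weierstrassSigma L z * weierstrassSigma L (z + d))) (g := fun z ↦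
      C * (weierstrassSigma L (z - c) * weierstrassSigma L (z + d + c))) ?_
      (by fun_prop) ?_ ⟨hz, hzd⟩
    · refine ContinuousOn.mul (fun w hw ↦ ?_) (by fun_prop)
      exact (hasDerivAt_zetaDefect hw.1 hw.2).continuousAt.continuousWithinAt
    · intro w _ hw
      rw [← hC w hw]
      obtain ⟨-, -, hwc, hwdc⟩ := hmem w hw
      have hσ₁ := weierstrassSigma_ne_zero L hwc
      have hσ₂ := weierstrassSigma_ne_zero L hwdc
      field_simp
  refine ⟨C, ?_, key⟩
  -- If C = 0, then G vanishes identically, hence so does its derivative ℘(z) - ℘(z+d).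
  rintro rfl
  have hzero : ∀ z, z ∉ L.lattice → z + d ∉ L.lattice → zetaDefect L z d = 0 := by
    intro z hz hzd
    have := key z hz hzd
    simpa [weierstrassSigma_ne_zero L hz, weierstrassSigma_ne_zero L hzd] using this
  obtain ⟨z, hz, hzd, hne⟩ := not_forall_weierstrassP_add_eq d hd
  refine hne (sub_eq_zero.mp ((hasDerivAt_zetaDefect hz hzd).unique
    ((hasDerivAt_const z (0 : ℂ)).congr_of_eventuallyEq ?_)))
  filter_upwards [L.isClosed_lattice.isOpen_compl.mem_nhds hz,
    (isOpen_compl_latticeSub L d).mem_nhds hzd] with v hv hvd using hzero v hv hvd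

end

/-! ### Hermite–Halphen functions and Lamé's equation -/

section

/-- `c` is a zero of `ζ(z + d) - ζ(z) - ζ(d)`. -/
structure IsNode (L : PeriodPair) (d c : ℂ) : Prop where
  notMem_d : d ∉ L.lattice
  notMem : c ∉ L.lattice
  notMem_add : c + d ∉ L.lattice
  zero : zetaDefect L c d = 0

/-- The Hermite–Halphen function `σ(z - c) σ(z + d) / σ(z)² exp((ζ(c) - ζ(d)) z)`. -/
noncomputable def halphen (L : PeriodPair) (d c z : ℂ) : ℂ :=
  weierstrassSigma L (z - c) * weierstrassSigma L (z + d) / weierstrassSigma L z ^ 2 *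
    Complex.exp ((weierstrassZeta L c - weierstrassZeta L d) * z)

variable {L : PeriodPair} {c d : ℂ}

lemma IsNode.reflect (h : IsNode L d c) : IsNode L d (-d - c) where
  notMem_d := h.notMem_d
  notMem H := h.notMem_add (by simpa [add_comm] using neg_mem H)
  notMem_add H := h.notMem (by simpa using neg_mem H)
  zero := by rw [zetaDefect_reflect, h.zero]

lemma IsNode.zeta_add (h : IsNode L d c) :
    weierstrassZeta L (c + d) = weierstrassZeta L c + weierstrassZeta L d := by
  have := h.zero
  rw [zetaDefect] at this
  linear_combination this

lemma IsNode.wp_add (h : IsNode L d c) :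
    L.weierstrassP c + L.weierstrassP (c + d) + L.weierstrassP d = 0 := by
  have := zetaDefect_sq h.notMem_d h.notMem h.notMem_add
  rw [h.zero] at this
  linear_combination -this

lemma differentiableOn_halphen : DifferentiableOn ℂ (halphen L d c) (L.lattice : Set ℂ)ᶜ := by
  intro z hz
  have hσ := differentiable_weierstrassSigma L
  have hz := pow_ne_zero 2 (weierstrassSigma_ne_zero L hz)
  have : DifferentiableAt ℂ (halphen L d c) z := by
    unfold halphen
    refine DifferentiableAt.fun_mul (DifferentiableAt.fun_div ?_ ?_ hz) (by fun_prop) <;>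
      fun_prop
  exact this.differentiableWithinAt

lemma analyticOnNhd_halphen : AnalyticOnNhd ℂ (halphen L d c) (L.lattice : Set ℂ)ᶜ :=
  differentiableOn_halphen.analyticOnNhd L.isClosed_lattice.isOpen_compl

lemma halphen_ne_zero {z : ℂ} (hz : z ∉ L.lattice) (hzc : z - c ∉ L.lattice)
    (hzd : z + d ∉ L.lattice) : halphen L d c z ≠ 0 :=
  mul_ne_zero (div_ne_zero (mul_ne_zero (weierstrassSigma_ne_zero L hzc)
    (weierstrassSigma_ne_zero L hzd)) (pow_ne_zero 2 (weierstrassSigma_ne_zero L hz)))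
    (Complex.exp_ne_zero _)

/-- The exponent ζ(c) - ζ(d) is chosen so that the logarithmic derivative splits into two functions
G, to which the addition theorem applies. -/
lemma hasDerivAt_halphen {z : ℂ} (hz : z ∉ L.lattice) (hzc : z - c ∉ L.lattice)
    (hzd : z + d ∉ L.lattice) : HasDerivAt (halphen L d c)
      ((zetaDefect L z (-c) + zetaDefect L z d) * halphen L d c z) z := by
  have hσ := weierstrassSigma_ne_zero L hz
  have h₁ := (hasDerivAt_sigma_sub hzc).mul (hasDerivAt_sigma_add hzd)
  have h₂ := (hasDerivAt_weierstrassSigma L hz).fun_pow 2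
  have h₃ := ((hasDerivAt_id z).const_mul (weierstrassZeta L c - weierstrassZeta L d)).cexp
  refine ((h₁.div h₂ (pow_ne_zero 2 hσ)).mul h₃).congr_deriv ?_
  simp only [Pi.mul_apply, Pi.div_apply, halphen, zetaDefect, weierstrassZeta_neg,
    ← sub_eq_add_neg, id]
  field_simp
  ring

lemma isClosed_halphen_zeros (L : PeriodPair) (d c : ℂ) :
    IsClosed (((L.lattice : Set ℂ) ∪ latticeSub L (-c)) ∪ latticeSub L d) :=
  (L.isClosed_lattice.union (isClosed_latticeSub L (-c))).union (isClosed_latticeSub L d)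

lemma countable_halphen_zeros (L : PeriodPair) (d c : ℂ) :
    (((L.lattice : Set ℂ) ∪ latticeSub L (-c)) ∪ latticeSub L d).Countable :=
  ((countable_lattice L).union (countable_latticeSub L (-c))).union (countable_latticeSub L d)

lemma notMem_halphen_zeros {z : ℂ}
    (hz : z ∉ ((L.lattice : Set ℂ) ∪ latticeSub L (-c)) ∪ latticeSub L d) :
    z ∉ L.lattice ∧ z - c ∉ L.lattice ∧ z + d ∉ L.lattice := by
  simpa [and_assoc, ← sub_eq_add_neg] using hz

/-- The Hermite–Halphen function solves Lamé's equation `φ'' = (6 ℘ - 3 ℘(c + d)) φ`. -/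
theorem IsNode.lame_halphen (h : IsNode L d c) {z : ℂ} (hz : z ∉ L.lattice) :
    deriv (deriv (halphen L d c)) z =
      (6 * L.weierstrassP z - 3 * L.weierstrassP (c + d)) * halphen L d c z := by
  refine eqOn_of_eq_off_countable L.isClosed_lattice.isOpen_compl (countable_halphen_zeros L d c)
    analyticOnNhd_halphen.deriv.deriv.continuousOn (g := fun z ↦
      (6 * L.weierstrassP z - 3 * L.weierstrassP (c + d)) * halphen L d c z) ?_
      (fun w _ hw ↦ ?_) hz
  · have h₁ := L.analyticOnNhd_weierstrassP.continuousOn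
    have h₂ := (analyticOnNhd_halphen (L := L) (c := c) (d := d)).continuousOn
    fun_prop
  · obtain ⟨hw₁, hw₂, hw₃⟩ := notMem_halphen_zeros hw
    have hw₂' : w + -c ∉ L.lattice := by rwa [← sub_eq_add_neg]
    have h₁ := ((hasDerivAt_zetaDefect hw₁ hw₂').add (hasDerivAt_zetaDefect hw₁ hw₃)).mul
      (hasDerivAt_halphen hw₁ hw₂ hw₃)
    have h₂ := h₁.congr_of_eventuallyEq (f₁ := deriv (halphen L d c)) (by
      filter_upwards [(isClosed_halphen_zeros L d c).isOpen_compl.mem_nhds hw] with v hv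
      obtain ⟨hv₁, hv₂, hv₃⟩ := notMem_halphen_zeros hv
      exact (hasDerivAt_halphen hv₁ hv₂ hv₃).deriv)
    rw [h₂.deriv]
    have hA := zetaDefect_sq (neg_mem_iff.not.mpr h.notMem) hw₁ hw₂'
    have hB := zetaDefect_sq h.notMem_d hw₁ hw₃
    have hAB := zetaDefect_mul_zetaDefect h.notMem_d h.notMem h.notMem_add h.zero hw₁ hw₂ hw₃
    rw [L.weierstrassP_neg] at hA
    simp only [Pi.add_apply]
    -- With A = G(w,-c) and B = G(w,d), φ''/φ = A' + B' + (A+B)² = 6℘(w) + 3℘(c) + 3℘(d), and ℘(c) +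
    -- ℘(d) = -℘(c+d).
    linear_combination halphen L d c w * (hA + hB + 2 * hAB + 3 * h.wp_add)

/-- Numerator and denominator contain two sigma factors each, so s² and exp(2ηz) cancel and only a
constant multiplier remains. -/
lemma exists_halphen_add {l : ℂ} (hl : l ∈ L.lattice) :
    ∃ m ≠ 0, ∀ z ∉ L.lattice, halphen L d c (z + l) = m * halphen L d c z := by
  obtain ⟨η, s, hs, -, hσ⟩ := exists_quasiPeriods hl
  refine ⟨Complex.exp (η * (d - c) + (weierstrassZeta L c - weierstrassZeta L d) * l),
    Complex.exp_ne_zero _, fun z hz ↦ ?_⟩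
  have h0 := weierstrassSigma_ne_zero L hz
  have e₁ : z + l - c = z - c + l := by ring
  have e₂ : z + l + d = z + d + l := by ring
  simp only [halphen, e₁, e₂, hσ]
  have e₃ : η * (z - c) = η * z + -(η * c) := by ring
  have e₄ : η * (d - c) = η * d + -(η * c) := by ring
  rw [e₃, e₄, mul_add _ z l, mul_add η z d]
  simp only [Complex.exp_add]
  field_simp [Complex.exp_ne_zero]

lemma halphen_neg_add {z l m : ℂ} (hm : m ≠ 0) (hl : l ∈ L.lattice)
    (h : ∀ z ∉ L.lattice, halphen L d c (z + l) = m * halphen L d c z) (hz : z ∉ L.lattice) :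
    halphen L d c (-(z + l)) = m⁻¹ * halphen L d c (-z) := by
  have hz' : -(z + l) ∉ L.lattice := by
    rw [neg_mem_iff, add_mem_lattice_iff L hl]; exact hz
  have := h _ hz'
  rw [show -(z + l) + l = -z by ring] at this
  rw [this]
  field_simp

/-- `6 G` as a product of Hermite–Halphen functions. -/
lemma IsNode.exists_zetaDefect_eq (h : IsNode L d c) :
    ∃ P ≠ 0, ∀ z, z ∉ L.lattice → z + d ∉ L.lattice →
      6 * zetaDefect L z d = P * (halphen L d c z * halphen L d c (-(z + d))) := by
  obtain ⟨C, hC, hz⟩ := exists_zetaDefect_factorization h.notMem_d h.notMem h.notMem_add h.zero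
  set k := weierstrassZeta L c - weierstrassZeta L d with hk
  refine ⟨6 * C * Complex.exp (k * d), by simp [hC], fun z h₁ h₂ ↦ ?_⟩
  have h₁' := weierstrassSigma_ne_zero L h₁
  have h₂' := weierstrassSigma_ne_zero L h₂
  have e₁ : -(z + d) - c = -(z + d + c) := by ring
  have e₂ : -(z + d) + d = -z := by ring
  have e₃ : k * -(z + d) = -(k * z + k * d) := by ring
  simp only [halphen, e₁, e₂, ← hk, e₃, weierstrassSigma_neg, Complex.exp_neg, Complex.exp_add]
  have e := hz z h₁ h₂
  rw [← eq_div_iff (mul_ne_zero h₁' h₂')] at e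
  rw [e]
  field_simp [Complex.exp_ne_zero]

/-- The cube replaces σ(z+d)/σ(z)² by σ(z)/σ(z+d)², which is the sigma part of the reflected
function. The exponentials match because ζ(c+d) = ζ(c) + ζ(d). This is the passage from u₂⁻ to u₁⁻.
-/
lemma IsNode.exists_halphen_mul (h : IsNode L d c) :
    ∃ M ≠ 0, ∀ z, z ∉ L.lattice → z + d ∉ L.lattice →
      halphen L d c z * (weierstrassSigma L z / weierstrassSigma L (z + d)) ^ 3 *
        Complex.exp (3 * weierstrassZeta L d * z) = M * halphen L d (-d - c) (-(z + d)) := by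
  have hζ : weierstrassZeta L (-d - c) = -(weierstrassZeta L c + weierstrassZeta L d) := by
    rw [← h.zeta_add, ← weierstrassZeta_neg]; congr 1; ring
  set k := weierstrassZeta L c + 2 * weierstrassZeta L d with hk
  refine ⟨Complex.exp (-(k * d)), Complex.exp_ne_zero _, fun z h₁ h₂ ↦ ?_⟩
  have h₁' := weierstrassSigma_ne_zero L h₁
  have h₂' := weierstrassSigma_ne_zero L h₂
  have e₁ : -(z + d) - (-d - c) = -(z - c) := by ring
  have e₂ : -(z + d) + d = -z := by ring
  have e₃ : (-(weierstrassZeta L c + weierstrassZeta L d) - weierstrassZeta L d) * -(z + d) =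
    (weierstrassZeta L c - weierstrassZeta L d) * z + 3 * weierstrassZeta L d * z + k * d := by
    rw [hk]; ring
  simp only [halphen, hζ, e₁, e₂, e₃, weierstrassSigma_neg, Complex.exp_neg, Complex.exp_add]
  field_simp [Complex.exp_ne_zero]

/-- If `φ(z)` and `φ(-z)` are proportional, then `c ≡ d`, or `c` and `d` are half periods. -/
lemma IsNode.of_dependent (h : IsNode L d c) {s t : ℂ} (hst : s ≠ 0 ∨ t ≠ 0)
    (hz : ∀ z ∉ L.lattice, s * halphen L d c (-z) + t * halphen L d c z = 0) :
    c - d ∈ L.lattice ∨ 2 * c ∈ L.lattice ∧ 2 * d ∈ L.lattice := by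
  have aux : ∀ v ∉ L.lattice, halphen L d c v = 0 → halphen L d c (-v) = 0 := by
    intro v hv h0
    have h₁ := hz v hv
    have h₂ := hz (-v) (neg_mem_iff.not.mpr hv)
    rw [neg_neg] at h₂
    simp only [h0, mul_zero, zero_add, add_zero, mul_eq_zero] at h₁ h₂
    tauto
  -- Dependence makes the zero set symmetric, so φ vanishes at -c and d as well as at c and -d.
  have hc := aux c h.notMem (by simp [halphen, weierstrassSigma_zero])
  have hd := aux (-d) (neg_mem_iff.not.mpr h.notMem_d) (by simp [halphen, weierstrassSigma_zero])
  by_contra! H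
  by_cases h2 : 2 * c ∈ L.lattice
  · refine halphen_ne_zero (z := d) h.notMem_d (fun h' ↦ H.1 (by simpa using neg_mem h'))
      (fun h' ↦ H.2 h2 (by rwa [two_mul])) (by simpa using hd)
  · refine halphen_ne_zero (z := -c) (neg_mem_iff.not.mpr h.notMem) (fun h' ↦ h2 ?_)
      (fun h' ↦ H.1 ?_) hc
    · convert neg_mem h' using 1; ring
    · convert neg_mem h' using 1; ring

/-- Here ℘(c) = ℘(d), so the sum gives ℘(c+d) = -2℘(d) and the product gives g₂ = 12℘(d)². -/
lemma IsNode.sq_wp_of_sub_mem (h : IsNode L d c) (hcd : c - d ∈ L.lattice) :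
    (3 * L.weierstrassP (c + d)) ^ 2 = 3 * L.g₂ := by
  have h₁ := weierstrassP_mul_of_zetaDefect_eq_zero h.notMem_d h.notMem h.notMem_add h.zero
  have h₂ := h.wp_add
  have h₃ : L.weierstrassP c = L.weierstrassP d := by
    rw [← weierstrassP_add L (z := d) hcd, add_sub_cancel]
  rw [h₃] at h₁ h₂
  have h₄ : L.weierstrassP (c + d) = -2 * L.weierstrassP d := by linear_combination h₂
  rw [h₄] at h₁ ⊢
  linear_combination (-12) * h₁

end

/-! ### Restriction to the real line: eigenfunctions, Bloch factors, independence -/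

section

variable {L : PeriodPair} {c d ω' : ℂ}

lemma exists_real_notMem {T : Set ℂ} (hT : T.Countable) (ω' : ℂ) : ∃ x : ℝ, (x : ℂ) + ω' ∉ T := by
  by_contra! h
  have hinj : Function.Injective fun x : ℝ ↦ (x : ℂ) + ω' := fun x y hxy ↦ by simpa using hxy
  have := hT.preimage hinj
  rw [show (fun x : ℝ ↦ (x : ℂ) + ω') ⁻¹' T = univ from eq_univ_of_forall h] at this
  exact not_countable_univ this

/-- An analytic solution of Lamé's equation restricts to an eigenfunction on the shifted line. -/
lemma isEigenfunction_of_lame {f : ℂ → ℂ} {a κ : ℂ} {u : ℝ → ℂ}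
    (hf : AnalyticOnNhd ℂ f (L.lattice : Set ℂ)ᶜ)
    (hode : ∀ z ∉ L.lattice, deriv (deriv f) z = (6 * L.weierstrassP z - a) * f z)
    (hreal : ∀ x : ℝ, (x : ℂ) + ω' ∉ L.lattice) (hne : ∃ x : ℝ, f (x + ω') ≠ 0) (hκ : κ ≠ 0)
    (hu : ∀ x : ℝ, u x = κ * f (x + ω')) :
    IsEigenfunction (fun x : ℝ ↦ V₀ L ω' x) a u := by
  have hu' : u = fun x : ℝ ↦ κ * f (x + ω') := funext hu
  have h₁ : ∀ x : ℝ, HasDerivAt u (κ * deriv f (x + ω')) x := by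
    intro x
    rw [hu']
    exact ((hf _ (hreal x)).differentiableAt.hasDerivAt.comp_add_const (x : ℂ)
      ω').comp_ofReal.const_mul κ
  have h₂ : ∀ x : ℝ, HasDerivAt (deriv u) (κ * deriv (deriv f) (x + ω')) x := by
    intro x
    rw [show deriv u = fun x : ℝ ↦ κ * deriv f (x + ω') from funext fun x ↦ (h₁ x).deriv]
    exact ((hf.deriv _ (hreal x)).differentiableAt.hasDerivAt.comp_add_const (x : ℂ)
      ω').comp_ofReal.const_mul κ
  refine ⟨?_, ?_, fun x ↦ ?_⟩
  · rw [hu', contDiff_iff_contDiffAt]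
    intro x
    have hfx : ContDiffAt ℝ 2 f ((x : ℂ) + ω') :=
      ((hf _ (hreal x)).contDiffAt (n := 2)).restrict_scalars ℝ
    exact contDiffAt_const.mul (hfx.comp x (f := fun x : ℝ ↦ (x : ℂ) + ω')
      (Complex.ofRealCLM.contDiff.contDiffAt.add contDiffAt_const))
  · obtain ⟨x, hx⟩ := hne
    exact ⟨x, by rw [hu]; exact mul_ne_zero hκ hx⟩
  · rw [(h₂ x).deriv, hode _ (hreal x), hu]
    simp only [V₀]
    ring

lemma analyticOnNhd_halphen_neg :
    AnalyticOnNhd ℂ (fun z ↦ halphen L d c (-z)) (L.lattice : Set ℂ)ᶜ := fun z hz ↦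
  (analyticOnNhd_halphen (-z) (neg_mem_iff.not.mpr hz : -z ∉ L.lattice)).fun_comp (by fun_prop)

lemma IsNode.lame_halphen_neg (h : IsNode L d c) {z : ℂ} (hz : z ∉ L.lattice) :
    deriv (deriv fun z ↦ halphen L d c (-z)) z =
      (6 * L.weierstrassP z - 3 * L.weierstrassP (c + d)) * halphen L d c (-z) := by
  have h₁ : (deriv fun z ↦ halphen L d c (-z)) = fun z ↦ -deriv (halphen L d c) (-z) :=
    funext fun z ↦ deriv_comp_neg _ z
  rw [h₁, deriv.fun_neg, deriv_comp_neg (f := deriv (halphen L d c)), neg_neg,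
    h.lame_halphen (neg_mem_iff.not.mpr hz), L.weierstrassP_neg]

lemma exists_real_halphen_ne_zero (d c : ℂ) (ω' : ℂ) : ∃ x : ℝ, halphen L d c (x + ω') ≠ 0 := by
  obtain ⟨x, hx⟩ := exists_real_notMem (countable_halphen_zeros L d c) ω'
  obtain ⟨h₁, h₂, h₃⟩ := notMem_halphen_zeros hx
  exact ⟨x, halphen_ne_zero h₁ h₂ h₃⟩

lemma exists_real_halphen_neg_ne_zero (d c : ℂ) (ω' : ℂ) :
    ∃ x : ℝ, halphen L d c (-(x + ω')) ≠ 0 := by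
  obtain ⟨x, hx⟩ := exists_real_notMem
    ((countable_halphen_zeros L d c).preimage neg_injective) ω'
  obtain ⟨h₁, h₂, h₃⟩ := notMem_halphen_zeros hx
  exact ⟨x, halphen_ne_zero h₁ h₂ h₃⟩

lemma IsNode.isEigenfunction (h : IsNode L d c) (hreal : ∀ x : ℝ, (x : ℂ) + ω' ∉ L.lattice)
    {κ : ℂ} (hκ : κ ≠ 0) {u : ℝ → ℂ} (hu : ∀ x : ℝ, u x = κ * halphen L d c (x + ω')) :
    IsEigenfunction (fun x : ℝ ↦ V₀ L ω' x) (3 * L.weierstrassP (c + d)) u :=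
  isEigenfunction_of_lame analyticOnNhd_halphen (fun _ hz ↦ h.lame_halphen hz) hreal
    (exists_real_halphen_ne_zero d c ω') hκ hu

lemma IsNode.isEigenfunction_neg (h : IsNode L d c) (hreal : ∀ x : ℝ, (x : ℂ) + ω' ∉ L.lattice)
    {κ : ℂ} (hκ : κ ≠ 0) {u : ℝ → ℂ} (hu : ∀ x : ℝ, u x = κ * halphen L d c (-(x + ω'))) :
    IsEigenfunction (fun x : ℝ ↦ V₀ L ω' x) (3 * L.weierstrassP (c + d)) u :=
  isEigenfunction_of_lame analyticOnNhd_halphen_neg (fun _ hz ↦ h.lame_halphen_neg hz) hreal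
    (exists_real_halphen_neg_ne_zero d c ω') hκ hu

/-- `u(x) = κ φ(x + ω')` and `v(x) = κ' φ(-(x + ω'))` have reciprocal Bloch factors. -/
lemma exists_bloch_factor (hreal : ∀ x : ℝ, (x : ℂ) + ω' ∉ L.lattice)
    {T : ℝ} (hT : (T : ℂ) ∈ L.lattice) {κ κ' : ℂ} {u v : ℝ → ℂ}
    (hu : ∀ x : ℝ, u x = κ * halphen L d c (x + ω'))
    (hv : ∀ x : ℝ, v x = κ' * halphen L d c (-(x + ω'))) :
    ∃ β : ℂ, β ≠ 0 ∧ ∀ x, u (x + T) = β * u x ∧ v (x + T) = β⁻¹ * v x := by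
  obtain ⟨m, hm, h⟩ := exists_halphen_add (d := d) (c := c) hT
  refine ⟨m, hm, fun x ↦ ⟨?_, ?_⟩⟩
  · rw [hu, hu, Complex.ofReal_add, add_right_comm, h _ (hreal x)]; ring
  · rw [hv, hv, Complex.ofReal_add, add_right_comm, halphen_neg_add hm hT h (hreal x)]; ring

lemma IsNode.linearIndependent (h : IsNode L d c) (hreal : ∀ x : ℝ, (x : ℂ) + ω' ∉ L.lattice)
    (hnd : ¬ (c - d ∈ L.lattice ∨ 2 * c ∈ L.lattice ∧ 2 * d ∈ L.lattice))
    {κ κ' : ℂ} (hκ : κ ≠ 0) (hκ' : κ' ≠ 0) {u v : ℝ → ℂ}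
    (hu : ∀ x : ℝ, u x = κ * halphen L d c (x + ω'))
    (hv : ∀ x : ℝ, v x = κ' * halphen L d c (-(x + ω'))) :
    LinearIndependent ℂ ![v, u] := by
  rw [LinearIndependent.pair_iff]
  intro s t hst
  by_contra hne
  refine hnd (h.of_dependent (s := s * κ') (t := t * κ) ?_ fun z hz ↦ ?_)
  · simp only [ne_eq, mul_eq_zero, hκ, hκ', or_false]; tauto
  · have hF : AnalyticOnNhd ℂ (fun z ↦ s * κ' * halphen L d c (-z) + t * κ * halphen L d c z)
        (L.lattice : Set ℂ)ᶜ := by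
      intro z hz
      have h₁ := analyticOnNhd_halphen (d := d) (c := c) z hz
      have h₂ := analyticOnNhd_halphen_neg (d := d) (c := c) z hz
      fun_prop
    -- A nonzero analytic F has countably many zeros, but a dependence on ℝ makes it vanish on the
    -- whole line ℝ + ω'.
    by_contra hFz
    have hcount := countable_zeros hF (isPreconnected_compl (countable_lattice L)) hz hFz
    obtain ⟨x, hx⟩ := exists_real_notMem hcount ω'
    refine hx ⟨hreal x, ?_⟩
    have := congrFun hst x
    simp only [Pi.add_apply, Pi.smul_apply, smul_eq_mul, Pi.zero_apply, hu, hv] at this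
    linear_combination this

/-! ### Half periods and band edges -/

variable {ω t : ℝ}

lemma add_half_period_notMem (ht : 0 < t) (hω' : ω' = t * Complex.I) (hL₁ : L.ω₁ = 2 * ω)
    (hL₂ : L.ω₂ = 2 * ω') (x : ℝ) : (x : ℂ) + ω' ∉ L.lattice := by
  rw [PeriodPair.mem_lattice]
  rintro ⟨m, n, h⟩
  have := congrArg Complex.im h
  rw [hL₁, hL₂, hω'] at this
  simp at this
  have h2 : (2 * n : ℝ) = 1 := by
    apply mul_right_cancel₀ ht.ne'
    linarith
  have : 2 * n = 1 := by exact_mod_cast h2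
  omega

/-- The values of `℘` at the points of order two. -/
lemma weierstrassP_half_period (hL₁ : L.ω₁ = 2 * ω) (hL₂ : L.ω₂ = 2 * ω') {z : ℂ}
    (hz : z ∉ L.lattice) (h2 : 2 * z ∈ L.lattice) :
    L.weierstrassP z = L.weierstrassP ω ∨ L.weierstrassP z = L.weierstrassP (ω + ω') ∨
      L.weierstrassP z = L.weierstrassP ω' := by
  obtain ⟨m, n, h⟩ := PeriodPair.mem_lattice.mp h2
  rw [hL₁, hL₂] at h
  have hz' : z = m * ω + n * ω' := by linear_combination -h / 2
  have hmem : ∀ i j : ℤ, (i : ℂ) * (2 * ω) + j * (2 * ω') ∈ L.lattice := fun i j ↦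
    PeriodPair.mem_lattice.mpr ⟨i, j, by rw [hL₁, hL₂]⟩
  rcases Int.even_or_odd' m with ⟨i, rfl | rfl⟩ <;> rcases Int.even_or_odd' n with ⟨j, rfl | rfl⟩
  · refine absurd ?_ hz
    rw [hz']; convert hmem i j using 1; push_cast; ring
  · right; right
    rw [← weierstrassP_add L (z := ω') (hmem i j), hz']; congr 1; push_cast; ring
  · left
    rw [← weierstrassP_add L (z := ω) (hmem i j), hz']; congr 1; push_cast; ring
  · right; left
    rw [← weierstrassP_add L (z := ω + ω') (hmem i j), hz']; congr 1; push_cast; ring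

lemma IsNode.isBandEdge (h : IsNode L d c) (hL₁ : L.ω₁ = 2 * ω) (hL₂ : L.ω₂ = 2 * ω')
    (hdep : c - d ∈ L.lattice ∨ 2 * c ∈ L.lattice ∧ 2 * d ∈ L.lattice) :
    IsBandEdge L ω ω' (3 * L.weierstrassP (c + d)) := by
  rcases hdep with hcd | ⟨hc, hd⟩
  · exact .inr (.inr (.inr (h.sq_wp_of_sub_mem hcd)))
  · have h2 : 2 * (c + d) ∈ L.lattice := by rw [mul_add]; exact add_mem hc hd
    rcases weierstrassP_half_period hL₁ hL₂ h.notMem_add h2 with e | e | e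
    · exact .inl (by rw [e])
    · exact .inr (.inl (by rw [e]))
    · exact .inr (.inr (.inl (by rw [e])))

end

/-! ### The nodes and the explicit formulas -/

section

variable {L : PeriodPair} {d ω' r x₁ x₂ : ℂ}

lemma IsNodePair.wp_add (h2 : 2 * ω' ∈ L.lattice) (hn : IsNodePair L ω' d r x₁ x₂) :
    L.weierstrassP (x₁ + ω' + d) = L.weierstrassP (x₂ + ω') := by
  rw [← L.weierstrassP_neg (x₂ + ω'), ← weierstrassP_add L (z := -(x₂ + ω')) (add_mem hn.sheet h2)]
  congr 1; ring

/-- The sheet condition makes x₁+ω'+d ≡ -(x₂+ω'), so the addition theorem reads G² = ℘(x₁+ω') +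
℘(x₂+ω') + ℘(d) = 0. -/
lemma IsNodePair.isNode (hd : d ∉ L.lattice) (h2 : 2 * ω' ∈ L.lattice)
    (hn : IsNodePair L ω' d r x₁ x₂) : IsNode L d (x₁ + ω') := by
  have hmem : x₁ + ω' + d ∉ L.lattice := by
    intro h
    refine hn.notMem₂ ?_
    convert sub_mem (add_mem hn.sheet h2) h using 1; ring
  refine ⟨hd, hn.notMem₁, hmem, ?_⟩
  have := zetaDefect_sq hd hn.notMem₁ hmem
  rw [hn.wp_add h2, hn.wp₁, hn.wp₂] at this
  exact pow_eq_zero_iff two_ne_zero |>.mp (by rw [this]; ring)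

lemma exists_isNodePair (hd : d ∉ L.lattice) (h2 : 2 * ω' ∈ L.lattice)
    (hr : r ^ 2 = L.g₂ - 3 * L.weierstrassP d ^ 2) : ∃ x₁ x₂, IsNodePair L ω' d r x₁ x₂ := by
  obtain ⟨z, hz, hzd, h0⟩ := exists_zetaDefect_eq_zero hd
  have hsum := (IsNode.mk hd hz hzd h0).wp_add
  have hprod := weierstrassP_mul_of_zetaDefect_eq_zero hd hz hzd h0
  have hzd' : -d - z ∉ L.lattice := fun h ↦ hzd (by simpa [add_comm] using neg_mem h)
  have hP : L.weierstrassP (-d - z) = L.weierstrassP (z + d) := by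
    rw [← L.weierstrassP_neg (z + d)]; congr 1; ring
  have hq : (2 * L.weierstrassP z + L.weierstrassP d) ^ 2 = r ^ 2 := by
    rw [hr]
    linear_combination (-4) * hprod + 4 * L.weierstrassP z * hsum
  -- The sign of the square root r decides which of the zeros z and -d-z serves as x₁+ω'.
  rcases sq_eq_sq_iff_eq_or_eq_neg.mp hq with h | h
  · refine ⟨z - ω', -d - z - ω', ?_, ?_, ?_, ?_, ?_⟩
    · simpa using hz
    · simpa using hzd'
    · rw [sub_add_cancel]; linear_combination h / 2
    · rw [sub_add_cancel, hP]; linear_combination hsum - h / 2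
    · convert neg_mem h2 using 1; ring
  · refine ⟨-d - z - ω', z - ω', ?_, ?_, ?_, ?_, ?_⟩
    · simpa using hzd'
    · simpa using hz
    · rw [sub_add_cancel, hP]; linear_combination hsum - h / 2
    · rw [sub_add_cancel]; linear_combination h / 2
    · convert neg_mem h2 using 1; ring

lemma p_eq {x : ℂ} (hd : d ∉ L.lattice) (h₁ : x + ω' ∉ L.lattice) (h₂ : x + ω' + d ∉ L.lattice)
    (hD : D L ω' d x ≠ 0) : p L ω' d x = 6 * zetaDefect L (x + ω') d := by
  have e : ∀ y : ℂ, y + d + ω' = y + ω' + d := fun y ↦ by ring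
  have hS : HasDerivAt (S L ω' d)
      (6 * (L.derivWeierstrassP (x + ω') + L.derivWeierstrassP (x + ω' + d))) x := by
    have a₁ := ((hasDerivAt_weierstrassP L h₁).comp_add_const x ω').const_mul 6
    have a₂ := ((hasDerivAt_weierstrassP L (z := x + (ω' + d))
      (by rwa [← add_assoc])).comp_add_const x (ω' + d)).const_mul 6
    refine ((a₁.add a₂).congr_of_eventuallyEq (.of_forall fun y ↦ ?_)).congr_deriv ?_
    · simp only [S, V₀, Pi.add_apply, e, add_assoc]
    · simp only [add_assoc]; ring
  have key := two_mul_zetaDefect_mul hd h₁ h₂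
  have hD' : D L ω' d x = 6 * (L.weierstrassP (x + ω') - L.weierstrassP (x + ω' + d)) := by
    rw [D, V₀, V₀, e]; ring
  rw [p, hS.deriv, ← key, mul_div_assoc', div_eq_iff hD, hD']
  ring

lemma countable_exceptionalSet (hd : d ∉ L.lattice) (ω' x₁ x₂ : ℂ) :
    (exceptionalSet L ω' d x₁ x₂).Countable := by
  have hT : ((L.lattice : Set ℂ) ∪ latticeSub L d).Countable :=
    (countable_lattice L).union (countable_latticeSub L d)
  have han : AnalyticOnNhd ℂ (fun z ↦ L.weierstrassP z - L.weierstrassP (z + d))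
      ((L.lattice : Set ℂ) ∪ latticeSub L d)ᶜ := by
    intro z hz
    rw [compl_union] at hz
    have h₂ : AnalyticAt ℂ (fun z ↦ L.weierstrassP (z + d)) z :=
      AnalyticAt.fun_comp (f := fun z ↦ z + d) (L.analyticOnNhd_weierstrassP _ hz.2) (by fun_prop)
    exact (L.analyticOnNhd_weierstrassP z hz.1).sub h₂
  obtain ⟨z₀, hz₀, hz₀d, hne⟩ := not_forall_weierstrassP_add_eq d hd
  have hzeros := countable_zeros han (isPreconnected_compl hT) (z₀ := z₀)
    (by simp [hz₀, hz₀d]) (sub_ne_zero.mpr hne)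
  refine ((((countable_latticeSub L ω').union (countable_latticeSub L (ω' + d))).union
    ((countable_latticeSub L (-x₁)).union (countable_latticeSub L (-x₂)))).union
    (hzeros.preimage (add_left_injective ω'))).mono ?_
  intro x hx
  by_cases h₁ : x + ω' ∈ L.lattice
  · exact .inl (.inl (.inl h₁))
  by_cases h₂ : x + ω' + d ∈ L.lattice
  · exact .inl (.inl (.inr (by simpa [add_assoc] using h₂)))
  rcases hx with h | h | h | h | h
  · exact absurd h h₁
  · exact absurd h h₂
  · exact .inl (.inr (.inl (by simpa [← sub_eq_add_neg] using h)))
  · exact .inl (.inr (.inr (by simpa [← sub_eq_add_neg] using h)))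
  · refine .inr ⟨by simp [h₁, h₂], ?_⟩
    rw [D, V₀, V₀, add_right_comm x d] at h
    simp only
    linear_combination h / 6

lemma notMem_exceptionalSet (h2 : 2 * ω' ∈ L.lattice) (hn : IsNodePair L ω' d r x₁ x₂) {x : ℂ}
    (hx : x ∉ exceptionalSet L ω' d x₁ x₂) :
    x + ω' ∉ L.lattice ∧ x + ω' + d ∉ L.lattice ∧ x + ω' - (x₁ + ω') ∉ L.lattice ∧
      x + ω' + d + (x₁ + ω') ∉ L.lattice ∧ D L ω' d x ≠ 0 := by
  simp only [exceptionalSet, mem_ofPred_eq, not_or] at hx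
  obtain ⟨h₁, h₂, h₃, h₄, h₅⟩ := hx
  refine ⟨h₁, h₂, by simpa using h₃, fun h ↦ h₄ ?_, h₅⟩
  convert sub_mem h (add_mem hn.sheet h2) using 1; ring

/-- Squaring removes every branch choice, since the principal powers satisfy (w^(1/2))² = w and
(w^(3/2))² = w³ for all w. -/
lemma sq_rootFormula (x : ℂ) : rootFormula L ω' d x₁ x₂ x ^ 2 = p L ω' d x *
    (weierstrassSigma L (x + ω' + d) / weierstrassSigma L (x + ω')) ^ 3 *
    (weierstrassSigma L (x - x₁) / weierstrassSigma L (x - x₂)) *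
    Complex.exp ((2 * b L ω' x₁ x₂ - 3 * weierstrassZeta L d) * x) := by
  have h₁ : ∀ w : ℂ, (w ^ (1 / 2 : ℂ)) ^ 2 = w := fun w ↦ by
    rw [← Complex.cpow_nat_mul]; norm_num
  have h₃ : ∀ w : ℂ, (w ^ (3 / 2 : ℂ)) ^ 2 = w ^ 3 := fun w ↦ by
    rw [← Complex.cpow_nat_mul]; norm_num
  rw [rootFormula, mul_pow, mul_pow, mul_pow, h₁, h₁, h₃, ← Complex.exp_nat_mul]
  congr 2
  push_cast; ring

/-- The square of the root formula is a constant times the square of a Hermite–Halphen function. -/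
lemma exists_sq_rootFormula (hd : d ∉ L.lattice) (h2 : 2 * ω' ∈ L.lattice)
    (hn : IsNodePair L ω' d r x₁ x₂) : ∃ K ≠ 0, ∀ x ∉ exceptionalSet L ω' d x₁ x₂,
      rootFormula L ω' d x₁ x₂ x ^ 2 = K * halphen L d (x₁ + ω') (x + ω') ^ 2 := by
  have h := hn.isNode hd h2
  set c := x₁ + ω' with hc
  obtain ⟨C, hC, hfac⟩ := exists_zetaDefect_factorization h.notMem_d h.notMem h.notMem_add h.zero
  have hlam : -(x₁ + x₂ + d + 2 * ω') ∈ L.lattice := neg_mem (add_mem hn.sheet h2)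
  obtain ⟨η, s, hs, hηζ, hησ⟩ := exists_quasiPeriods hlam
  obtain ⟨η', -, -, hη', -⟩ := exists_quasiPeriods h2
  -- The increment for 2ω' cancels in the difference. The increment η stays, and compensates the
  -- factor exp(ηx) that σ(x-x₂) acquires on translation to σ(x+ω'+d+c).
  have hb : 2 * b L ω' x₁ x₂ = 2 * weierstrassZeta L c + weierstrassZeta L d + η := by
    have e₁ : ω' - x₁ = -c + 2 * ω' := by rw [hc]; ring
    have e₂ : ω' - x₂ = (c + d) + -(x₁ + x₂ + d + 2 * ω') + 2 * ω' := by rw [hc]; ring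
    rw [b, e₁, e₂, hη' _ (neg_mem_iff.not.mpr h.notMem),
      hη' _ ((add_mem_lattice_iff L hlam).not.mpr h.notMem_add), hηζ _ h.notMem_add, h.zeta_add,
      weierstrassZeta_neg]
    ring
  set k := weierstrassZeta L c - weierstrassZeta L d with hk
  refine ⟨6 * C / s * Complex.exp (-(2 * k + η) * ω' - η * (d + c)), by simp [hC, hs],
    fun x hx ↦ ?_⟩
  obtain ⟨hz, hzd, hzc, hzdc, hD⟩ := notMem_exceptionalSet h2 hn hx
  rw [← hc] at hzc hzdc
  have e₁ : x - x₁ = x + ω' - c := by rw [hc]; ring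
  have e₂ : x - x₂ = x + ω' + d + c + -(x₁ + x₂ + d + 2 * ω') := by rw [hc]; ring
  rw [sq_rootFormula, p_eq hd hz hzd hD, hb, e₁, e₂, hησ, halphen, ← hk]
  have e := hfac _ hz hzd
  have hz' := weierstrassSigma_ne_zero L hz
  have hzd' := weierstrassSigma_ne_zero L hzd
  have hzdc' := weierstrassSigma_ne_zero L hzdc
  rw [← eq_div_iff (mul_ne_zero hz' hzd')] at e
  rw [e, mul_pow, ← Complex.exp_nat_mul]
  have e₃ : (2 * weierstrassZeta L c + weierstrassZeta L d + η - 3 * weierstrassZeta L d) * x =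
      (-(2 * k + η) * ω' - η * (d + c)) + (2 : ℕ) * (k * (x + ω')) + η * (x + ω' + d + c) := by
    rw [hk]; push_cast; ring
  rw [e₃, Complex.exp_add _ (η * (x + ω' + d + c)), Complex.exp_add]
  field_simp [Complex.exp_ne_zero]

lemma isOpen_regularSet (L : PeriodPair) (ω' : ℂ) : IsOpen (regularSet L ω') :=
  isOpen_compl_latticeSub L ω'

lemma differentiableOn_halphen_add {c : ℂ} :
    DifferentiableOn ℂ (fun x ↦ halphen L d c (x + ω')) (regularSet L ω') :=
  differentiableOn_halphen.comp (f := fun x ↦ x + ω') (by fun_prop) fun _ hx ↦ hx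

lemma differentiableOn_halphen_neg_add {c : ℂ} :
    DifferentiableOn ℂ (fun x ↦ halphen L d c (-(x + ω'))) (regularSet L ω') :=
  differentiableOn_halphen.comp (f := fun x ↦ -(x + ω')) (by fun_prop)
    fun _ hx ↦ neg_mem_iff.not.mpr hx

/-- If f - g is not identically zero, its zeros are countable and f = -g elsewhere. The pointwise
sign in the root formula thus becomes one global sign. -/
lemma eqOn_or_eqOn_neg_of_sq {f g : ℂ → ℂ} {U S : Set ℂ} (hU : IsOpen U) (hUc : IsPreconnected U)
    (hS : S.Countable) (hf : DifferentiableOn ℂ f U) (hg : DifferentiableOn ℂ g U)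
    (h : ∀ z ∈ U, z ∉ S → f z ^ 2 = g z ^ 2) : EqOn f g U ∨ EqOn f (fun z ↦ -g z) U := by
  by_contra! H
  obtain ⟨z₀, hz₀, hne⟩ : ∃ z ∈ U, f z ≠ g z := by simpa [EqOn] using H.1
  have hz := countable_zeros ((hf.sub hg).analyticOnNhd hU) hUc hz₀ (sub_ne_zero.mpr hne)
  refine H.2 (eqOn_of_eq_off_countable hU (hS.union hz) hf.continuousOn hg.continuousOn.neg
    fun z hzU hzS ↦ ?_)
  rw [mem_union, not_or] at hzS
  refine (sq_eq_sq_iff_eq_or_eq_neg.mp (h z hzU hzS.1)).resolve_left fun e ↦ hzS.2 ⟨hzU, ?_⟩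
  simp [e]

lemma halphen_ne_zero_of_notMem_exceptionalSet (h2 : 2 * ω' ∈ L.lattice)
    (hn : IsNodePair L ω' d r x₁ x₂) {x : ℂ} (hx : x ∉ exceptionalSet L ω' d x₁ x₂) :
    halphen L d (x₁ + ω') (x + ω') ≠ 0 ∧
      halphen L d (-d - (x₁ + ω')) (-(x + ω' + d)) ≠ 0 := by
  obtain ⟨hz, hzd, hzc, -, -⟩ := notMem_exceptionalSet h2 hn hx
  refine ⟨halphen_ne_zero hz hzc hzd, halphen_ne_zero (neg_mem_iff.not.mpr hzd) ?_ ?_⟩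
  · rwa [show -(x + ω' + d) - (-d - (x₁ + ω')) = -(x + ω' - (x₁ + ω')) by ring, neg_mem_iff]
  · rwa [show -(x + ω' + d) + d = -(x + ω') by ring, neg_mem_iff]

variable {u₂m u₂p u₁m u₁p : ℂ → ℂ}

/-- The functions given by the formulas are multiples of Hermite–Halphen functions. -/
lemma IsGivenByFormulas.exists_halphen (hd : d ∉ L.lattice) (h2 : 2 * ω' ∈ L.lattice)
    (hn : IsNodePair L ω' d r x₁ x₂) (H : IsGivenByFormulas L ω' d x₁ x₂ u₂m u₂p u₁m u₁p) :
    ∃ k₁ k₂ k₃ k₄ : ℂ, (k₁ ≠ 0 ∧ k₂ ≠ 0 ∧ k₃ ≠ 0 ∧ k₄ ≠ 0) ∧ ∀ x ∈ regularSet L ω',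
      u₂m x = k₁ * halphen L d (x₁ + ω') (x + ω') ∧
      u₂p x = k₂ * halphen L d (x₁ + ω') (-(x + ω')) ∧
      u₁m x = k₃ * halphen L d (-d - (x₁ + ω')) (-(x + ω')) ∧
      u₁p x = k₄ * halphen L d (-d - (x₁ + ω')) (x + ω') := by
  have hc := hn.isNode hd h2
  obtain ⟨K, hK, hroot⟩ := exists_sq_rootFormula hd h2 hn
  obtain ⟨P, hP, hp⟩ := hc.exists_zetaDefect_eq
  obtain ⟨P', hP', hp'⟩ := hc.reflect.exists_zetaDefect_eq
  obtain ⟨M, hM, hm⟩ := hc.exists_halphen_mul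
  set c := x₁ + ω' with hcdef
  have hE := countable_exceptionalSet hd ω' x₁ x₂
  have hEd : ((fun x ↦ x - d) ⁻¹' exceptionalSet L ω' d x₁ x₂).Countable :=
    hE.preimage (sub_left_injective)
  have hU := isOpen_regularSet L ω'
  have hUc : IsPreconnected (regularSet L ω') := isPreconnected_compl (countable_latticeSub L ω')
  have hφ : ∀ {c' k : ℂ}, DifferentiableOn ℂ (fun x ↦ k * halphen L d c' (x + ω'))
      (regularSet L ω') := differentiableOn_halphen_add.const_mul _
  have hφn : ∀ {c' k : ℂ}, DifferentiableOn ℂ (fun x ↦ k * halphen L d c' (-(x + ω')))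
      (regularSet L ω') := differentiableOn_halphen_neg_add.const_mul _
  obtain ⟨k₁, hk₁, e₁⟩ : ∃ k₁ ≠ 0, ∀ x ∈ regularSet L ω', u₂m x = k₁ * halphen L d c (x + ω') := by
    obtain ⟨κ, hκ⟩ := IsAlgClosed.exists_pow_nat_eq K two_pos
    have hκ0 : κ ≠ 0 := by rintro rfl; exact hK (by simpa using hκ.symm)
    rcases eqOn_or_eqOn_neg_of_sq hU hUc hE H.holo_two_minus (hφ (c' := c) (k := κ))
      (fun x _ hx ↦ by
        rw [mul_pow, hκ, ← hroot x hx, sq_eq_sq_iff_eq_or_eq_neg]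
        exact H.formula_two_minus x hx) with h | h
    · exact ⟨κ, hκ0, h⟩
    · exact ⟨-κ, neg_ne_zero.mpr hκ0, fun x hx ↦ (h hx).trans (by ring)⟩
  have hreg : ∀ x ∉ exceptionalSet L ω' d x₁ x₂, x ∈ regularSet L ω' := fun x hx ↦
    (notMem_exceptionalSet h2 hn hx).1
  have e₂ : EqOn u₂p (fun x ↦ P / k₁ * halphen L d c (-(x + ω'))) (regularSet L ω') := by
    refine eqOn_of_eq_off_countable hU hEd H.holo_two_plus.continuousOn hφn.continuousOn
      fun y _ hy ↦ ?_
    obtain ⟨x, rfl⟩ : ∃ x, y = x + d := ⟨y - d, by ring⟩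
    have hx : x ∉ exceptionalSet L ω' d x₁ x₂ := by simpa using hy
    obtain ⟨hz, hzd, -, -, hD⟩ := notMem_exceptionalSet h2 hn hx
    have hne := (halphen_ne_zero_of_notMem_exceptionalSet h2 hn hx).1
    rw [← hcdef] at hne
    rw [H.formula_two_plus x hx, e₁ x (hreg x hx), p_eq hd hz hzd hD, hp _ hz hzd,
      add_right_comm x d]
    field_simp
  -- The formula for u₁⁻ has exp(3ζ(d)x), while `IsNode.exists_halphen_mul` has z = x+ω' in the
  -- exponent.
  set N := Complex.exp (-(3 * weierstrassZeta L d * ω')) with hN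
  have hN0 : N ≠ 0 := Complex.exp_ne_zero _
  have f₃ : ∀ x ∉ exceptionalSet L ω' d x₁ x₂,
      u₁m (x + d) = k₁ * M * N * halphen L d (-d - c) (-(x + ω' + d)) := by
    intro x hx
    obtain ⟨hz, hzd, -, -, -⟩ := notMem_exceptionalSet h2 hn hx
    rw [H.formula_one_minus x hx, e₁ x (hreg x hx), mul_right_comm _ N, mul_assoc k₁ M,
      ← hm _ hz hzd, show 3 * weierstrassZeta L d * x = 3 * weierstrassZeta L d * (x + ω') +
        -(3 * weierstrassZeta L d * ω') by ring, Complex.exp_add]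
    ring
  have e₃ : EqOn u₁m (fun x ↦ k₁ * M * N * halphen L d (-d - c) (-(x + ω')))
      (regularSet L ω') := by
    refine eqOn_of_eq_off_countable hU hEd H.holo_one_minus.continuousOn hφn.continuousOn
      fun y _ hy ↦ ?_
    obtain ⟨x, rfl⟩ : ∃ x, y = x + d := ⟨y - d, by ring⟩
    rw [f₃ x (by simpa using hy), add_right_comm x d]
  have e₄ : EqOn u₁p (fun x ↦ P' / (k₁ * M * N) * halphen L d (-d - c) (x + ω'))
      (regularSet L ω') := by
    refine eqOn_of_eq_off_countable hU hE H.holo_one_plus.continuousOn hφ.continuousOn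
      fun x _ hx ↦ ?_
    obtain ⟨hz, hzd, -, -, hD⟩ := notMem_exceptionalSet h2 hn hx
    have hne := (halphen_ne_zero_of_notMem_exceptionalSet h2 hn hx).2
    rw [← hcdef] at hne
    rw [H.formula_one_plus x hx, f₃ x hx, p_eq hd hz hzd hD, hp' _ hz hzd]
    field_simp
  exact ⟨k₁, P / k₁, k₁ * M * N, P' / (k₁ * M * N),
    ⟨hk₁, div_ne_zero hP hk₁, by simp [hk₁, hM, hN0], by simp [hP', hk₁, hM, hN0]⟩,
    fun x hx ↦ ⟨e₁ x hx, e₂ hx, e₃ hx, e₄ hx⟩⟩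

/-- Multiples of Hermite–Halphen functions satisfy the formulas. -/
lemma exists_isGivenByFormulas (hd : d ∉ L.lattice) (h2 : 2 * ω' ∈ L.lattice)
    (hn : IsNodePair L ω' d r x₁ x₂) :
    ∃ u₂m u₂p u₁m u₁p : ℂ → ℂ, IsGivenByFormulas L ω' d x₁ x₂ u₂m u₂p u₁m u₁p := by
  have hc := hn.isNode hd h2
  obtain ⟨K, hK, hroot⟩ := exists_sq_rootFormula hd h2 hn
  obtain ⟨P, hP, hp⟩ := hc.exists_zetaDefect_eq
  obtain ⟨P', hP', hp'⟩ := hc.reflect.exists_zetaDefect_eq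
  obtain ⟨M, hM, hm⟩ := hc.exists_halphen_mul
  obtain ⟨k, hk⟩ := IsAlgClosed.exists_pow_nat_eq K two_pos
  have hk0 : k ≠ 0 := by rintro rfl; exact hK (by simpa using hk.symm)
  set c := x₁ + ω' with hcdef
  set N := Complex.exp (-(3 * weierstrassZeta L d * ω')) with hN
  have hN0 : N ≠ 0 := Complex.exp_ne_zero _
  refine ⟨fun x ↦ k * halphen L d c (x + ω'), fun x ↦ P / k * halphen L d c (-(x + ω')),
    fun x ↦ k * M * N * halphen L d (-d - c) (-(x + ω')),
    fun x ↦ P' / (k * M * N) * halphen L d (-d - c) (x + ω'),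
    differentiableOn_halphen_add.const_mul _, differentiableOn_halphen_neg_add.const_mul _,
    differentiableOn_halphen_neg_add.const_mul _, differentiableOn_halphen_add.const_mul _,
    fun x hx ↦ ?_, fun x hx ↦ ?_, fun x hx ↦ ?_, fun x hx ↦ ?_⟩
  · rw [← sq_eq_sq_iff_eq_or_eq_neg, hroot x hx, mul_pow, hk]
  · obtain ⟨hz, hzd, -, -, hD⟩ := notMem_exceptionalSet h2 hn hx
    have hne := (halphen_ne_zero_of_notMem_exceptionalSet h2 hn hx).1
    rw [← hcdef] at hne
    rw [p_eq hd hz hzd hD, hp _ hz hzd, add_right_comm x d]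
    field_simp
  · obtain ⟨hz, hzd, -, -, -⟩ := notMem_exceptionalSet h2 hn hx
    rw [add_right_comm x d, mul_right_comm _ N, mul_assoc k M,
      ← hm _ hz hzd, show 3 * weierstrassZeta L d * x = 3 * weierstrassZeta L d * (x + ω') +
        -(3 * weierstrassZeta L d * ω') by ring, Complex.exp_add]
    ring
  · obtain ⟨hz, hzd, -, -, hD⟩ := notMem_exceptionalSet h2 hn hx
    have hne := (halphen_ne_zero_of_notMem_exceptionalSet h2 hn hx).2
    rw [← hcdef] at hne
    rw [p_eq hd hz hzd hD, hp' _ hz hzd, add_right_comm x d]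
    field_simp

end

end LameInce

/-! ### The theorem -/

theorem proposition3 (L : PeriodPair) (ω t : ℝ) (hω : 0 < ω) (ht : 0 < t) (ω' : ℂ)
    (hω' : ω' = t * Complex.I) (hL₁ : L.ω₁ = 2 * ω) (hL₂ : L.ω₂ = 2 * ω')
    (d : ℂ) (hd : d ∉ L.lattice)
    (r : ℂ) (hr : r ^ 2 = L.g₂ - 3 * L.weierstrassP d ^ 2) :
    (∃ x₁ x₂ : ℂ, LameInce.IsNodePair L ω' d r x₁ x₂) ∧
    ∀ x₁ x₂ : ℂ, LameInce.IsNodePair L ω' d r x₁ x₂ →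
      (∃ u₂m u₂p u₁m u₁p : ℂ → ℂ,
        LameInce.IsGivenByFormulas L ω' d x₁ x₂ u₂m u₂p u₁m u₁p) ∧
      ∀ u₂m u₂p u₁m u₁p : ℂ → ℂ,
        LameInce.IsGivenByFormulas L ω' d x₁ x₂ u₂m u₂p u₁m u₁p →
        LameInce.IsBlochPair (fun x : ℝ => LameInce.V₀ L ω' x) (2 * ω) (LameInce.a₂ L d r)
          (fun x : ℝ => u₂p x) (fun x : ℝ => u₂m x) ∧
        LameInce.IsBlochPair (fun x : ℝ => LameInce.V₀ L ω' x) (2 * ω) (LameInce.a₁ L d r)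
          (fun x : ℝ => u₁p x) (fun x : ℝ => u₁m x) ∧
        (¬ LameInce.IsBandEdge L ω ω' (LameInce.a₂ L d r) →
          LinearIndependent ℂ ![fun x : ℝ => u₂p x, fun x : ℝ => u₂m x]) ∧
        (¬ LameInce.IsBandEdge L ω ω' (LameInce.a₁ L d r) →
          LinearIndependent ℂ ![fun x : ℝ => u₁p x, fun x : ℝ => u₁m x]) := by
  have h2 : 2 * ω' ∈ L.lattice := hL₂ ▸ L.ω₂_mem_lattice
  have hT : ((2 * ω : ℝ) : ℂ) ∈ L.lattice := by
    rw [Complex.ofReal_mul, Complex.ofReal_ofNat, ← hL₁]; exact L.ω₁_mem_lattice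
  have hreal := LameInce.add_half_period_notMem ht hω' hL₁ hL₂
  refine ⟨LameInce.exists_isNodePair hd h2 hr, fun x₁ x₂ hn ↦
    ⟨LameInce.exists_isGivenByFormulas hd h2 hn, fun u₂m u₂p u₁m u₁p H ↦ ?_⟩⟩
  obtain ⟨k₁, k₂, k₃, k₄, ⟨hk₁, hk₂, hk₃, hk₄⟩, hu⟩ := H.exists_halphen hd h2 hn
  have hc := hn.isNode hd h2
  have ha₂ : LameInce.a₂ L d r = 3 * L.weierstrassP (x₁ + ω' + d) := by
    rw [hn.wp_add h2, hn.wp₂, LameInce.a₂]; ring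
  have ha₁ : LameInce.a₁ L d r = 3 * L.weierstrassP (-d - (x₁ + ω') + d) := by
    rw [show -d - (x₁ + ω') + d = -(x₁ + ω') by ring, L.weierstrassP_neg, hn.wp₁, LameInce.a₁]
    ring
  have hu₂m : ∀ x : ℝ, u₂m x = k₁ * _ := fun x ↦ (hu x (hreal x)).1
  have hu₂p : ∀ x : ℝ, u₂p x = k₂ * _ := fun x ↦ (hu x (hreal x)).2.1
  have hu₁m : ∀ x : ℝ, u₁m x = k₃ * _ := fun x ↦ (hu x (hreal x)).2.2.1
  have hu₁p : ∀ x : ℝ, u₁p x = k₄ * _ := fun x ↦ (hu x (hreal x)).2.2.2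
  rw [ha₁, ha₂]
  refine ⟨⟨hc.isEigenfunction_neg hreal hk₂ hu₂p, hc.isEigenfunction hreal hk₁ hu₂m, ?_⟩,
    ⟨hc.reflect.isEigenfunction hreal hk₄ hu₁p, hc.reflect.isEigenfunction_neg hreal hk₃ hu₁m,
      LameInce.exists_bloch_factor hreal hT hu₁p hu₁m⟩, fun hb ↦ ?_, fun hb ↦ ?_⟩
  -- For i = 2 it is u₂⁻ that is a multiple of φ(x+ω'), so the factor of u₂⁺ is the inverse; for i =
  -- 1 the roles are reversed.
  · obtain ⟨β, hβ, h⟩ := LameInce.exists_bloch_factor hreal hT hu₂m hu₂p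
    exact ⟨β⁻¹, inv_ne_zero hβ, fun x ↦ ⟨(h x).2, by rw [inv_inv]; exact (h x).1⟩⟩
  · exact hc.linearIndependent hreal (fun hdep ↦ hb (hc.isBandEdge hL₁ hL₂ hdep)) hk₁ hk₂ hu₂m hu₂p
  · rw [LinearIndependent.pair_symm_iff]
    exact hc.reflect.linearIndependent hreal
      (fun hdep ↦ hb (hc.reflect.isBandEdge hL₁ hL₂ hdep)) hk₄ hk₃ hu₁p hu₁m
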